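/- Let $\mathbb N=\{1,2,\dots\}$. Define families of finite subsets of $\mathbb N$ by $\mathcal F_0=\{\emptyset\}\cup\{\{n\}:n\in\mathbb N\}$ and $\mathcal F_{n+1}=\{\emptyset\}\cup\{\bigcup_{i=1}^dA_i : d\in\mathbb N,\ A_i\in\mathcal F_n,\ d\le A_1<A_2<\dots<A_d\}$, where $A<B$ means $a<b$ for all $a\in A$, $b\in B$, and $d\le A$ means $d\le a$ for all $a\in A$. For a family $\mathcal M$ of finite subsets of $\mathbb N$, a sequence $(E_i)_{i=1}^d$ of nonempty finite subsets of $\mathbb N$ with $\{\min E_1,\dots,\min E_d\}\in\mathcal M$ is called $\mathcal M$-allowable if the $E_i$ are pairwise disjoint, and $\mathcal M$-admissible if $E_1<\dots<E_d$. Let $(m_j)_{j\ge1}$, $(t_j)_{j\ge2}$, $(k_j)_{j\ge1}$ be any sequences of positive integers such that $m_1=2$, $m_j>m_{j-1}^{m_{j-1}}$ for $j\ge2$, $2^{t_j}\ge m_j^2$ for $j\ge2$, $k_1=1$, and $k_j=t_j(k_{j-1}+1)+1$ for $j\ge2$. Let $K^0=\{\pm e_n:n\in\mathbb N\}\subset c_{00}$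 (the real finitely supported sequences on $\mathbb N$), and for $s\ge0$ let $K^{s+1}$ be the union of $K^s$ and of the set of all $\frac1{m_j}(f_1+\dots+f_d)$ with $j,d\ge1$, $f_1,\dots,f_d\in K^s$, such that $(\operatorname{supp}f_i)_{i=1}^d$ is $\mathcal F_{k_1}$-allowable if $j=1$, and $\mathcal F_{k_j}$-admissible if $j\ge2$. Put $K=\bigcup_sK^s$, and let $X_{M(1),u}=T_{M(1)}[(\mathcal F_{k_j},1/m_j)_{j\ge1}]$ be the completion of $c_{00}$ under the norm $\|x\|=\sup_{f\in K}\sum_nx(n)f(n)$. Theorem 2.18. The Banach space $X_{M(1),u}$ is arbitrarily distortable: for every $\lambda>1$ there is an equivalent norm $|\cdot|$ on $X_{M(1),u}$ such that every infinite-dimensional subspace $Y$ satisfies $$\sup\Big\{\frac{|y|}{|z|}:\ y,z\in Y,\ \|y\|=\|z\|=1\Big\}\ge\lambda .$$ -/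

import Mathlib

open Finset

/-! ### Schreier families, admissible and allowable sequences of sets

The set of positive integers is `ℕ+`. -/

/-- `E < F` for finite sets of positive integers: every element of `E` is smaller than every
element of `F`. -/
def SetLT (E F : Finset ℕ+) : Prop := ∀ a ∈ E, ∀ b ∈ F, a < b

/-- The Schreier families `𝓕_n`, for finite `n`. -/
def schreier : ℕ → Set (Finset ℕ+)
  | 0 => {A | A = ∅ ∨ ∃ p : ℕ+, A = {p}}
  | n + 1 => {A | A = ∅ ∨ ∃ (d : ℕ) (B : Fin d → Finset ℕ+),
      (∀ i, B i ∈ schreier n) ∧ (∀ i, ∀ a ∈ B i, d ≤ (a : ℕ)) ∧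
      (∀ i j, i < j → SetLT (B i) (B j)) ∧ A = Finset.univ.biUnion B}

/-- A finite sequence of nonempty finite sets is `M`-admissible if the sets are successive and the
set of their minima belongs to `M`. -/
def IsAdmissible (M : Set (Finset ℕ+)) {d : ℕ} (E : Fin d → Finset ℕ+) : Prop :=
  (∀ i j, i < j → SetLT (E i) (E j)) ∧
  ∃ h : ∀ i, (E i).Nonempty, Finset.univ.image (fun i => (E i).min' (h i)) ∈ M

/-- A finite sequence of nonempty finite sets is `M`-allowable if the sets are pairwise disjoint
and the set of their minima belongs to `M`. -/
def IsAllowable (M : Set (Finset ℕ+)) {d : ℕ} (E : Fin d → Finset ℕ+) : Prop :=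
  (∀ i j, i ≠ j → Disjoint (E i) (E j)) ∧
  ∃ h : ∀ i, (E i).Nonempty, Finset.univ.image (fun i => (E i).min' (h i)) ∈ M

lemma IsAdmissible.disjoint {M : Set (Finset ℕ+)} {d : ℕ} {E : Fin d → Finset ℕ+}
    (h : IsAdmissible M E) (i j : Fin d) (hij : i ≠ j) : Disjoint (E i) (E j) := by
  rw [Finset.disjoint_left]
  intro a hi hj
  rcases lt_or_gt_of_ne hij with h1 | h1
  · exact lt_irrefl a (h.1 i j h1 a hi a hj)
  · exact lt_irrefl a (h.1 j i h1 a hj a hi)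

/-! ### Boundedly modified mixed Tsirelson spaces

The space `c₀₀` of finitely supported real sequences is `ℕ+ →₀ ℝ`. Sequences `(M_j)`, `(θ_j)`
start at `j = 1`; their values at `j = 0` are never used. -/

/-- The condition imposed at index `j` on the supports: `M_j`-allowable if `j ≤ s`,
`M_j`-admissible if `j > s`. -/
def IsGoodFamily (s : ℕ) (M : ℕ → Set (Finset ℕ+)) (j : ℕ) {d : ℕ}
    (E : Fin d → Finset ℕ+) : Prop :=
  (j ≤ s → IsAllowable (M j) E) ∧ (s < j → IsAdmissible (M j) E)

lemma IsGoodFamily.disjoint {s : ℕ} {M : ℕ → Set (Finset ℕ+)} {j d : ℕ}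
    {E : Fin d → Finset ℕ+} (h : IsGoodFamily s M j E) (i i' : Fin d) (hi : i ≠ i') :
    Disjoint (E i) (E i') := by
  rcases le_or_gt j s with h1 | h1
  · exact (h.1 h1).1 i i' hi
  · exact (h.2 h1).disjoint i i' hi

/-- The sets `K^n`: `K^0 = {± e_p}`, and `K^(n+1)` consists of `K^n` and of all functionals
`θ_j (f_1 + ⋯ + f_d)` with `j, d ≥ 1` and `f_i ∈ K^n`, where the sequence of supports is
`M_j`-allowable if `j ≤ s` and `M_j`-admissible if `j > s`. -/
def normingLevel (s : ℕ) (M : ℕ → Set (Finset ℕ+)) (θ : ℕ → ℝ) : ℕ → Set (ℕ+ →₀ ℝ)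
  | 0 => {g | ∃ p : ℕ+, g = Finsupp.single p 1 ∨ g = -Finsupp.single p 1}
  | n + 1 => normingLevel s M θ n ∪
      {g | ∃ j : ℕ, 1 ≤ j ∧ ∃ (d : ℕ) (f : Fin d → (ℕ+ →₀ ℝ)), 1 ≤ d ∧
        (∀ i, f i ∈ normingLevel s M θ n) ∧
        IsGoodFamily s M j (fun i => (f i).support) ∧ g = θ j • ∑ i, f i}

/-- The norming set `K = ⋃ₙ K^n`. -/
def normingSet (s : ℕ) (M : ℕ → Set (Finset ℕ+)) (θ : ℕ → ℝ) : Set (ℕ+ →₀ ℝ) :=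
  ⋃ n, normingLevel s M θ n

/-- The pairing `⟨x, f⟩ = ∑ₙ x(n) f(n)` on `c₀₀`. -/
noncomputable def pairing (x f : ℕ+ →₀ ℝ) : ℝ := x.sum fun n a => a * f n

/-- The norm `‖x‖ = sup {⟨x, f⟩ : f ∈ K}` on `c₀₀`. -/
noncomputable def tsirelsonNorm (s : ℕ) (M : ℕ → Set (Finset ℕ+)) (θ : ℕ → ℝ)
    (x : ℕ+ →₀ ℝ) : ℝ :=
  sSup ((fun f => pairing x f) '' normingSet s M θ)

lemma pairing_add (x y f : ℕ+ →₀ ℝ) : pairing (x + y) f = pairing x f + pairing y f := by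
  unfold pairing
  exact Finsupp.sum_add_index' (by simp) (by intros; ring)

lemma pairing_smul (c : ℝ) (x f : ℕ+ →₀ ℝ) : pairing (c • x) f = c * pairing x f := by
  unfold pairing
  rw [Finsupp.sum_smul_index' (by simp), Finsupp.mul_sum]
  simp [mul_assoc]

lemma pairing_neg_right (x f : ℕ+ →₀ ℝ) : pairing x (-f) = -pairing x f := by
  simp [pairing, Finsupp.sum, Finset.sum_neg_distrib]

lemma neg_mem_normingSet {s : ℕ} {M : ℕ → Set (Finset ℕ+)} {θ : ℕ → ℝ} {f : ℕ+ →₀ ℝ}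
    (hf : f ∈ normingSet s M θ) : -f ∈ normingSet s M θ := by
  obtain ⟨n, hn⟩ := Set.mem_iUnion.1 hf
  refine Set.mem_iUnion.2 ⟨n, ?_⟩
  clear hf
  induction n generalizing f with
  | zero =>
    obtain ⟨p, rfl | rfl⟩ := hn
    · exact ⟨p, Or.inr rfl⟩
    · exact ⟨p, Or.inl (neg_neg _)⟩
  | succ n ih =>
    rcases hn with hn | ⟨j, hj, d, g, hd, hg, hgood, rfl⟩
    · exact Or.inl (ih hn)
    · refine Or.inr ⟨j, hj, d, fun i => -g i, hd, fun i => ih (hg i), ?_, ?_⟩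
      · simpa only [Finsupp.support_neg] using hgood
      · rw [Finset.sum_neg_distrib, smul_neg]

lemma abs_apply_le_one {s : ℕ} {M : ℕ → Set (Finset ℕ+)} {θ : ℕ → ℝ}
    (hθ : ∀ j, 0 ≤ θ j ∧ θ j ≤ 1) {f : ℕ+ →₀ ℝ} (hf : f ∈ normingSet s M θ) (p : ℕ+) :
    |f p| ≤ 1 := by
  obtain ⟨n, hn⟩ := Set.mem_iUnion.1 hf
  clear hf
  induction n generalizing f with
  | zero =>
    obtain ⟨q, rfl | rfl⟩ := hn
    · by_cases h : q = p <;> simp [h]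
    · by_cases h : q = p <;> simp [h]
  | succ n ih =>
    rcases hn with hn | ⟨j, hj, d, g, hd, hg, hgood, rfl⟩
    · exact ih hn
    · have hs : |∑ i, g i p| ≤ 1 := by
        by_cases hz : ∀ i, g i p = 0
        · simp [hz]
        · push Not at hz
          obtain ⟨i, hi⟩ := hz
          rw [Finset.sum_eq_single i]
          · exact ih (hg i)
          · intro i' _ hne
            by_contra h
            exact Finset.disjoint_left.1 (hgood.disjoint i' i hne)
              (Finsupp.mem_support_iff.2 h) (Finsupp.mem_support_iff.2 hi)
          · simp
      have : (θ j • ∑ i, g i) p = θ j * ∑ i, g i p := by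
        simp
      rw [this, abs_mul, abs_of_nonneg (hθ j).1]
      exact mul_le_one₀ (hθ j).2 (abs_nonneg _) hs

lemma bddAbove_pairing {s : ℕ} {M : ℕ → Set (Finset ℕ+)} {θ : ℕ → ℝ}
    (hθ : ∀ j, 0 ≤ θ j ∧ θ j ≤ 1) (x : ℕ+ →₀ ℝ) :
    BddAbove ((fun f => pairing x f) '' normingSet s M θ) := by
  refine ⟨∑ n ∈ x.support, |x n|, ?_⟩
  rintro _ ⟨f, hf, rfl⟩
  refine Finset.sum_le_sum fun n _ => ?_
  calc x n * f n ≤ |x n * f n| := le_abs_self _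
    _ = |x n| * |f n| := abs_mul _ _
    _ ≤ |x n| := mul_le_of_le_one_right (abs_nonneg _) (abs_apply_le_one hθ hf n)

lemma single_mem_normingSet (s : ℕ) (M : ℕ → Set (Finset ℕ+)) (θ : ℕ → ℝ) (p : ℕ+) :
    Finsupp.single p 1 ∈ normingSet s M θ :=
  Set.mem_iUnion.2 ⟨0, p, Or.inl rfl⟩

lemma pairing_le_norm {s : ℕ} {M : ℕ → Set (Finset ℕ+)} {θ : ℕ → ℝ}
    (hθ : ∀ j, 0 ≤ θ j ∧ θ j ≤ 1) (x : ℕ+ →₀ ℝ) {f : ℕ+ →₀ ℝ} (hf : f ∈ normingSet s M θ) :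
    |pairing x f| ≤ tsirelsonNorm s M θ x := by
  refine abs_le'.2 ⟨le_csSup (bddAbove_pairing hθ x) ⟨f, hf, rfl⟩, ?_⟩
  rw [← pairing_neg_right]
  exact le_csSup (bddAbove_pairing hθ x) ⟨-f, neg_mem_normingSet hf, rfl⟩

lemma norm_le_of_pairing {s : ℕ} {M : ℕ → Set (Finset ℕ+)} {θ : ℕ → ℝ} (x : ℕ+ →₀ ℝ) {c : ℝ}
    (h : ∀ f ∈ normingSet s M θ, pairing x f ≤ c) : tsirelsonNorm s M θ x ≤ c := by
  refine csSup_le ⟨_, _, single_mem_normingSet s M θ 1, rfl⟩ ?_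
  rintro _ ⟨f, hf, rfl⟩
  exact h f hf

/-- `c₀₀` as the underlying vector space of the normed space `(c₀₀, ‖·‖)` defined by
`s`, `(M_j)`, `(θ_j)`. -/
def PreTsirelson (_s : ℕ) (_M : ℕ → Set (Finset ℕ+)) (_θ : ℕ → unitInterval) : Type := ℕ+ →₀ ℝ

noncomputable instance (s : ℕ) (M : ℕ → Set (Finset ℕ+)) (θ : ℕ → unitInterval) :
    AddCommGroup (PreTsirelson s M θ) := inferInstanceAs (AddCommGroup (ℕ+ →₀ ℝ))

noncomputable instance (s : ℕ) (M : ℕ → Set (Finset ℕ+)) (θ : ℕ → unitInterval) :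
    Module ℝ (PreTsirelson s M θ) := inferInstanceAs (Module ℝ (ℕ+ →₀ ℝ))

noncomputable instance (s : ℕ) (M : ℕ → Set (Finset ℕ+)) (θ : ℕ → unitInterval) :
    Norm (PreTsirelson s M θ) := ⟨fun x => tsirelsonNorm s M (fun j => (θ j : ℝ)) x⟩

lemma preTsirelson_core (s : ℕ) (M : ℕ → Set (Finset ℕ+)) (θ : ℕ → unitInterval) :
    NormedSpace.Core ℝ (PreTsirelson s M θ) := by
  have hθ : ∀ j, 0 ≤ (θ j : ℝ) ∧ (θ j : ℝ) ≤ 1 := fun j => ⟨(θ j).2.1, (θ j).2.2⟩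
  have hnn : ∀ x : ℕ+ →₀ ℝ, 0 ≤ tsirelsonNorm s M (fun j => (θ j : ℝ)) x := fun x =>
    (abs_nonneg _).trans (pairing_le_norm hθ x (single_mem_normingSet s M _ 1))
  have hle : ∀ (c : ℝ) (x : ℕ+ →₀ ℝ), tsirelsonNorm s M (fun j => (θ j : ℝ)) (c • x) ≤
      |c| * tsirelsonNorm s M (fun j => (θ j : ℝ)) x := by
    intro c x
    refine norm_le_of_pairing _ fun f hf => ?_
    rw [pairing_smul]
    calc c * pairing x f ≤ |c * pairing x f| := le_abs_self _
      _ = |c| * |pairing x f| := abs_mul _ _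
      _ ≤ _ := mul_le_mul_of_nonneg_left (pairing_le_norm hθ x hf) (abs_nonneg _)
  refine ⟨⟨hnn, ?_, ?_⟩, ?_⟩
  · intro c x
    change tsirelsonNorm s M (fun j => (θ j : ℝ)) (c • (show ℕ+ →₀ ℝ from x)) =
      |c| * tsirelsonNorm s M (fun j => (θ j : ℝ)) x
    refine le_antisymm (hle c x) ?_
    by_cases hc : c = 0
    · simpa [hc] using hnn _
    · have h := hle c⁻¹ (c • (show ℕ+ →₀ ℝ from x))
      rw [smul_smul, inv_mul_cancel₀ hc, one_smul, abs_inv] at h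
      have hc' : 0 < |c| := abs_pos.2 hc
      calc _ ≤ |c| * (|c|⁻¹ * tsirelsonNorm s M (fun j => (θ j : ℝ))
                (c • (show ℕ+ →₀ ℝ from x))) :=
            mul_le_mul_of_nonneg_left h hc'.le
        _ = _ := by rw [← mul_assoc, mul_inv_cancel₀ hc'.ne', one_mul]
  · intro x y
    refine norm_le_of_pairing _ fun f hf => ?_
    exact (pairing_add x y f).trans_le (add_le_add
      ((le_abs_self _).trans (pairing_le_norm hθ x hf))
      ((le_abs_self _).trans (pairing_le_norm hθ y hf)))
  · intro x
    constructor
    · intro h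
      refine Finsupp.ext (M := ℝ) fun p => ?_
      have h1 := pairing_le_norm hθ (show ℕ+ →₀ ℝ from x) (single_mem_normingSet s M _ p)
      have h2 : tsirelsonNorm s M (fun j => (θ j : ℝ)) x = 0 := h
      have h3 : pairing x (Finsupp.single p 1) = (show ℕ+ →₀ ℝ from x) p := by
        classical
        simp only [pairing, Finsupp.sum, Finsupp.single_apply, mul_ite, mul_one, mul_zero]
        rw [Finset.sum_ite_eq]
        split_ifs with h4
        · rfl
        · exact (Finsupp.notMem_support_iff.1 h4).symm
      rw [h3, h2] at h1
      exact abs_eq_zero.1 (le_antisymm h1 (abs_nonneg _))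
    · rintro rfl
      have := hle 0 0
      rw [abs_zero, zero_mul, smul_zero] at this
      exact le_antisymm this (hnn _)

noncomputable instance (s : ℕ) (M : ℕ → Set (Finset ℕ+)) (θ : ℕ → unitInterval) :
    NormedAddCommGroup (PreTsirelson s M θ) :=
  NormedAddCommGroup.ofCore (preTsirelson_core s M θ)

noncomputable instance (s : ℕ) (M : ℕ → Set (Finset ℕ+)) (θ : ℕ → unitInterval) :
    NormedSpace ℝ (PreTsirelson s M θ) :=
  NormedSpace.ofCore (preTsirelson_core s M θ)

/-- The boundedly modified mixed Tsirelson space `T_{M(s)}[(M_j, θ_j)_{j ≥ 1}]`: the completion of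
`c₀₀` in the norm given by the norming set `K`. -/
abbrev BoundedlyModifiedMixedTsirelson (s : ℕ) (M : ℕ → Set (Finset ℕ+))
    (θ : ℕ → unitInterval) : Type :=
  UniformSpace.Completion (PreTsirelson s M θ)

/-- The number `1 / m` in `[0, 1]`. -/
noncomputable def recip (m : ℕ) : unitInterval :=
  ⟨1 / (m : ℝ), by positivity, by
    rw [one_div]; exact Nat.cast_inv_le_one m⟩

/-- The space `T_{M(1)}[(𝓕_{k_j}, 1 / m_j)_{j ≥ 1}]`. -/
abbrev SpaceXM1u (m k : ℕ → ℕ) : Type :=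
  BoundedlyModifiedMixedTsirelson 1 (fun j => schreier (k j)) (fun j => recip (m j))

/-! ### Distortion -/

/-- `X` is `lam`-distortable: there is an equivalent norm `N` on `X` such that on every
infinite-dimensional subspace `Y` the supremum of `N y / N z`, over `y, z ∈ Y` with
`‖y‖ = ‖z‖ = 1`, is at least `lam`. -/
def IsDistortable (X : Type*) [NormedAddCommGroup X] [NormedSpace ℝ X] (lam : ℝ) : Prop :=
  ∃ N : Seminorm ℝ X,
    (∃ c C : ℝ, 0 < c ∧ 0 < C ∧ ∀ x, c * ‖x‖ ≤ N x ∧ N x ≤ C * ‖x‖) ∧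
    ∀ Y : Submodule ℝ X, ¬ FiniteDimensional ℝ Y →
      lam ≤ sSup {r : ℝ | ∃ y ∈ Y, ∃ z ∈ Y, ‖y‖ = 1 ∧ ‖z‖ = 1 ∧ r = N y / N z}

/-- `X` is arbitrarily distortable: `lam`-distortable for every `lam > 1`. -/
def IsArbitrarilyDistortable (X : Type*) [NormedAddCommGroup X] [NormedSpace ℝ X] : Prop :=
  ∀ lam : ℝ, 1 < lam → IsDistortable X lam

/-! ### Schreier families -/

/-! For `s ≥ 2` let `N_s(x)` be the supremum of `|f(x)|` over the `f ∈ K` whose last operation has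
weight `1 / m_s`. This set of functionals contains `(1 / m_s) K`, so `(1 / m_s) ‖·‖ ≤ N_s ≤ ‖·‖` and
`N_s` is an equivalent norm. For every `t` there is one `s` such that each infinite-dimensional
subspace contains a flat vector, with `‖z‖ ≥ 1/2` and `N_s(z) ≤ 7 / m_s`, and a peak vector, with
`‖y‖ ≤ 2 (9/10)^t` and `N_s(y) ≥ 1 / (4 m_s)`. After normalization the ratio of the two values of
`N_s` is at least `(10/9)^t / 112`. A gliding hump (`exists_block_subspace`) reduces both
constructions to block subspaces of `c₀₀`.

Flat vectors. `exists_average` gives convex combinations of blocks that carry little mass on any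
`𝓕_n`-set, while sums of functionals along them stay `𝓕_(n+1)`-admissible. If all such averages with
`n = k_(j-1)` had norm below `1/2`, then averaging and renormalizing repeatedly would double the
pairing with an admissible sum at each step, up to order `m_j²`; since `1 / m_j` times that sum is
in `K`, a unit vector would have norm of order `m_j` (`exists_large_average`). On an average of norm
at least `1/2`, a functional of weight index `s < j` starts new pieces inside blocks of small total
mass only; on every other block at most one piece acts, and the value is at most `1 / m_s`
(`exists_unsplit_vector`).

Peak vectors. In a rapidly increasing sequence of such vectors each weight index is critical for at
most one term: smaller indices do not split the later terms and larger ones barely see the earlier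
terms. Averaging convex combinations of the sequence lowers the norm bound by the factor `9/10`
(`mixedNorm_average_le`), but keeps the pairing `1/2` with an admissible sum. The point is the
action of `f = (1/2) ∑ g_i` on a combination in which nothing special starts. The `g_i` that are
half sums have boundedly many disjoint summands in all, so half the sum of these summands is again
in `K` on vectors far out; these `g_i` therefore contribute at most half the bound. Those of small
weight index contribute a fifth and those of large index a tenth. Only disjointness of the `g_i`
enters, so allowability in place of admissibility at `j = 1` does no harm. After `t` rounds the
admissible sum has order `t (k_(s₀) + 2)`, and any `s` with `k_s` at least that large, chosen before
the subspace, turns it into a functional of weight `1 / m_s`. -/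

/-- Heredity and spreading in one statement, proved by splitting `S` along the pieces of `A`. It is
needed for restrictions of functionals, where some supports disappear and the minima of the others
move to the right. -/
theorem schreier_image {ι : Type*} [LinearOrder ι] {n : ℕ} {A : Finset ℕ+} (hA : A ∈ schreier n)
    (S : Finset ι) (u v : ι → ℕ+) (hu : ∀ x ∈ S, u x ∈ A) (hmu : StrictMonoOn u S)
    (hmv : StrictMonoOn v S) (huv : ∀ x ∈ S, u x ≤ v x) : S.image v ∈ schreier n := by
  classical
  induction n generalizing A S with
  | zero =>
    rcases S.eq_empty_or_nonempty with rfl | ⟨x, hx⟩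
    · left; simp
    · right
      refine ⟨v x, ?_⟩
      rcases hA with rfl | ⟨p, rfl⟩
      · simpa using hu x hx
      · have : S = {x} := by
          refine eq_singleton_iff_unique_mem.2 ⟨hx, fun y hy => hmu.injOn hy hx ?_⟩
          rw [mem_singleton.1 (hu x hx), mem_singleton.1 (hu y hy)]
        rw [this, image_singleton]
  | succ n ih =>
    rcases hA with rfl | ⟨d, B, hB, hd, hlt, rfl⟩
    · left
      rw [image_eq_empty]
      exact eq_empty_of_forall_notMem fun x hx => by simpa using hu x hx
    · refine Or.inr ⟨d, fun i => (S.filter fun x => u x ∈ B i).image v, fun i => ?_, ?_, ?_, ?_⟩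
      · exact ih (hB i) _ (fun x hx => (mem_filter.1 hx).2)
          (hmu.mono fun x hx => (mem_filter.1 hx).1) (hmv.mono fun x hx => (mem_filter.1 hx).1)
          (fun x hx => huv x (mem_filter.1 hx).1)
      · intro i a ha
        obtain ⟨x, hx, rfl⟩ := mem_image.1 ha
        rw [mem_filter] at hx
        exact (hd i _ hx.2).trans (huv x hx.1)
      · intro i j hij a ha b hb
        obtain ⟨x, hx, rfl⟩ := mem_image.1 ha
        obtain ⟨y, hy, rfl⟩ := mem_image.1 hb
        rw [mem_filter] at hx hy
        have h1 : u x < u y := hlt i j hij _ hx.2 _ hy.2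
        exact hmv hx.1 hy.1 ((hmu.lt_iff_lt hx.1 hy.1).1 h1)
      · ext a
        simp only [mem_image, mem_biUnion, mem_univ, true_and, mem_filter]
        constructor
        · rintro ⟨x, hx, rfl⟩
          obtain ⟨i, -, hi⟩ := mem_biUnion.1 (hu x hx)
          exact ⟨i, x, ⟨hx, hi⟩, rfl⟩
        · rintro ⟨i, x, ⟨hx, -⟩, rfl⟩
          exact ⟨x, hx, rfl⟩

theorem schreier_subset_succ {n : ℕ} {A : Finset ℕ+} (hA : A ∈ schreier n) :
    A ∈ schreier (n + 1) := by
  refine Or.inr ⟨1, fun _ => A, fun _ => hA, fun _ a _ => a.2, ?_, by simp⟩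
  intro i j hij
  exact absurd hij (by simp [Subsingleton.elim i j])

theorem schreier_mono {n n' : ℕ} (h : n ≤ n') {A : Finset ℕ+} (hA : A ∈ schreier n) :
    A ∈ schreier n' := by
  induction h with
  | refl => exact hA
  | step _ ih => exact schreier_subset_succ ih

theorem card_le_one_of_mem_schreier_zero {A : Finset ℕ+} (hA : A ∈ schreier 0) :
    A.card ≤ 1 := by
  rcases hA with rfl | ⟨p, rfl⟩ <;> simp

/-- With `mem_schreier_one` this identifies `𝓕_1` with the sets whose cardinality is at most their
minimum. -/
theorem card_le_of_mem_schreier_one {A : Finset ℕ+} (hA : A ∈ schreier 1) (a : ℕ+)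
    (ha : a ∈ A) : A.card ≤ a := by
  rcases hA with rfl | ⟨d, B, hB, hd, -, rfl⟩
  · simp at ha
  · obtain ⟨i, -, hi⟩ := mem_biUnion.1 ha
    calc (univ.biUnion B).card ≤ (univ : Finset (Fin d)).card * 1 :=
          card_biUnion_le_card_mul _ _ _ fun i _ => card_le_one_of_mem_schreier_zero (hB i)
      _ = d := by simp
      _ ≤ a := hd i a hi

theorem mem_schreier_one {A : Finset ℕ+} (h : ∀ a ∈ A, A.card ≤ a) : A ∈ schreier 1 := by
  refine Or.inr ⟨A.card, fun i => {A.orderEmbOfFin rfl i}, fun i => Or.inr ⟨_, rfl⟩, ?_, ?_, ?_⟩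
  · intro i a ha
    rw [mem_singleton.1 ha]
    exact h _ (A.orderEmbOfFin_mem rfl i)
  · intro i j hij a ha b hb
    rw [mem_singleton.1 ha, mem_singleton.1 hb]
    exact (A.orderEmbOfFin rfl).strictMono hij
  · ext a
    have : a ∈ A ↔ a ∈ univ.image (A.orderEmbOfFin rfl) := by rw [image_orderEmbOfFin_univ]
    rw [this, mem_image, mem_biUnion]
    simp only [mem_univ, true_and, mem_singleton, eq_comm]

/-- The families obtained from the singletons by unions of at most `d` sets, `d ≤ ⋃ Aᵢ`, without
requiring the sets to be successive. -/
def looseSchreier : ℕ → Set (Finset ℕ+)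
  | 0 => {A | A.card ≤ 1}
  | n + 1 => {A | ∃ (d : ℕ) (B : Fin d → Finset ℕ+), (∀ i, B i ∈ looseSchreier n) ∧
      (∀ a ∈ A, d ≤ (a : ℕ)) ∧ A ⊆ Finset.univ.biUnion B}

theorem schreier_subset_looseSchreier {n : ℕ} {A : Finset ℕ+} (hA : A ∈ schreier n) :
    A ∈ looseSchreier n := by
  induction n generalizing A with
  | zero => exact card_le_one_of_mem_schreier_zero hA
  | succ n ih =>
    rcases hA with rfl | ⟨d, B, hB, hd, -, rfl⟩
    · exact ⟨0, fun _ => ∅, fun i => i.elim0, by simp, by simp⟩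
    · refine ⟨d, B, fun i => ih (hB i), fun a ha => ?_, Subset.rfl⟩
      obtain ⟨i, -, hi⟩ := mem_biUnion.1 ha
      exact hd i a hi

theorem looseSchreier_mono {n n' : ℕ} (h : n ≤ n') {A : Finset ℕ+} (hA : A ∈ looseSchreier n) :
    A ∈ looseSchreier n' := by
  induction h with
  | refl => exact hA
  | step _ ih => exact ⟨1, fun _ => A, fun _ => ih, fun a _ => a.2, by simp⟩

theorem singleton_mem_looseSchreier (n : ℕ) (p : ℕ+) : {p} ∈ looseSchreier n :=
  looseSchreier_mono (Nat.zero_le n) (by simp [looseSchreier])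

theorem empty_mem_looseSchreier (n : ℕ) : ∅ ∈ looseSchreier n :=
  looseSchreier_mono (Nat.zero_le n) (by simp [looseSchreier])

theorem biUnion_filter_mem_looseSchreier {n d : ℕ} {B : Fin d → Finset ℕ+}
    (hB : ∀ i, B i ∈ looseSchreier n) :
    (univ.biUnion B).filter (fun a : ℕ+ => d ≤ (a : ℕ)) ∈ looseSchreier (n + 1) :=
  ⟨d, B, hB, fun _ ha => (mem_filter.1 ha).2, filter_subset _ _⟩

/-! ### The norming set -/

section Level
variable {s : ℕ} {M : ℕ → Set (Finset ℕ+)} {θ : ℕ → ℝ}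

theorem normingLevel_mono {n n' : ℕ} (h : n ≤ n') :
    normingLevel s M θ n ⊆ normingLevel s M θ n' := by
  induction h with
  | refl => exact Set.Subset.rfl
  | step _ ih => exact ih.trans fun f hf => Or.inl hf

theorem smul_sum_mem_normingSet {j d : ℕ} (hj : 1 ≤ j) (hd : 1 ≤ d) {f : Fin d → (ℕ+ →₀ ℝ)}
    (hf : ∀ i, f i ∈ normingSet s M θ) (hgood : IsGoodFamily s M j (fun i => (f i).support)) :
    θ j • ∑ i, f i ∈ normingSet s M θ := by
  have h1 : ∀ i, ∃ n, f i ∈ normingLevel s M θ n := fun i => Set.mem_iUnion.1 (hf i)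
  choose n hn using h1
  refine Set.mem_iUnion.2 ⟨univ.sup n + 1, Or.inr ⟨j, hj, d, f, hd, fun i => ?_, hgood, rfl⟩⟩
  exact normingLevel_mono (le_sup (mem_univ i)) (hn i)

end Level

/-- The norming set of `SpaceXM1u m k`. -/
def mixedSet (m k : ℕ → ℕ) : Set (ℕ+ →₀ ℝ) :=
  normingSet 1 (fun j => schreier (k j)) (fun j => ((recip (m j) : unitInterval) : ℝ))

/-- The norm of `SpaceXM1u m k` on `c₀₀`. -/
noncomputable def mixedNorm (m k : ℕ → ℕ) (x : ℕ+ →₀ ℝ) : ℝ :=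
  tsirelsonNorm 1 (fun j => schreier (k j)) (fun j => ((recip (m j) : unitInterval) : ℝ)) x

/-- The least element of the support (`1` for the zero vector). -/
noncomputable def minSupp (f : ℕ+ →₀ ℝ) : ℕ+ :=
  if h : f.support.Nonempty then f.support.min' h else 1

theorem minSupp_eq {f : ℕ+ →₀ ℝ} (h : f.support.Nonempty) : minSupp f = f.support.min' h :=
  dif_pos h

theorem minSupp_mem {f : ℕ+ →₀ ℝ} (h : f ≠ 0) : minSupp f ∈ f.support := by
  rw [minSupp_eq (Finsupp.support_nonempty_iff.2 h)]
  exact min'_mem _ _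

theorem minSupp_le {f : ℕ+ →₀ ℝ} {a : ℕ+} (h : a ∈ f.support) : minSupp f ≤ a := by
  rw [minSupp_eq ⟨a, h⟩]
  exact min'_le _ _ h

/-! ### Growth of the parameters -/

theorem coe_recip (n : ℕ) : ((recip n : unitInterval) : ℝ) = 1 / (n : ℝ) := rfl

/-- The growth properties of the parameters that are used. -/
structure GrowthData (m k : ℕ → ℕ) : Prop where
  m_one : m 1 = 2
  k_one : k 1 = 1
  five_le : ∀ j, 2 ≤ j → 5 ≤ m j
  m_mono : ∀ i j, 1 ≤ i → i ≤ j → m i ≤ m j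
  le_m : ∀ j, 1 ≤ j → j ≤ m j
  k_mono : ∀ i j, 1 ≤ i → i ≤ j → k i ≤ k j
  le_k : ∀ j, 1 ≤ j → j ≤ k j
  exists_iter : ∀ j, 2 ≤ j → ∃ t, m j ^ 2 ≤ 2 ^ t ∧ t * (k (j - 1) + 1) ≤ k j

theorem growthData_of_recursion {m t k : ℕ → ℕ} (hm1 : m 1 = 2)
    (hm : ∀ j, 2 ≤ j → m (j - 1) ^ m (j - 1) < m j)
    (ht : ∀ n, 2 ≤ n → m n ^ 2 ≤ 2 ^ t n)
    (hk1 : k 1 = 1)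
    (hk : ∀ n, 2 ≤ n → k n = t n * (k (n - 1) + 1) + 1) : GrowthData m k := by
  have hm2 : ∀ j, 1 ≤ j → 2 ≤ m j ∧ j ≤ m j := by
    intro j hj
    induction j, hj using Nat.le_induction with
    | base => simp [hm1]
    | succ j hj ih =>
      have h1 := hm (j + 1) (by omega)
      simp only [Nat.add_sub_cancel] at h1
      have : m j ≤ m j ^ m j := Nat.le_self_pow (by omega) _
      omega
  have hms : ∀ j, 1 ≤ j → m j ≤ m (j + 1) := by
    intro j hj
    have h1 := hm (j + 1) (by omega)
    simp only [Nat.add_sub_cancel] at h1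
    have : m j ≤ m j ^ m j := Nat.le_self_pow (by have := hm2 j hj; omega) _
    omega
  have hmm : ∀ i j, 1 ≤ i → i ≤ j → m i ≤ m j := by
    intro i j hi hij
    induction j, hij using Nat.le_induction with
    | base => exact le_rfl
    | succ j hj ih => exact ih.trans (hms j (hi.trans hj))
  have ht1 : ∀ j, 2 ≤ j → 1 ≤ t j := by
    intro j hj
    by_contra h
    have h0 : t j = 0 := by omega
    have h1 := ht j hj
    have h2 := (hm2 j (by omega)).1
    rw [h0, pow_zero] at h1
    nlinarith
  have hks : ∀ j, 1 ≤ j → k j + 1 ≤ k (j + 1) := by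
    intro j hj
    rw [hk (j + 1) (by omega), Nat.add_sub_cancel]
    nlinarith [ht1 (j + 1) (by omega)]
  refine ⟨hm1, hk1, ?_, hmm, fun j hj => (hm2 j hj).2, ?_, ?_, ?_⟩
  · intro j hj
    -- `m 2 > 2 ^ 2 = 4`, and this is the source of the constant `5`.
    have h1 := hm 2 le_rfl
    norm_num [hm1] at h1
    exact (Nat.succ_le_of_lt h1).trans (hmm 2 j (by norm_num) hj)
  · intro i j hi hij
    induction j, hij using Nat.le_induction with
    | base => exact le_rfl
    | succ j hj ih => have := hks j (hi.trans hj); omega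
  · intro j hj
    induction j, hj using Nat.le_induction with
    | base => simp [hk1]
    | succ j hj ih => have := hks j hj; omega
  · intro j hj
    exact ⟨t j, ht j hj, by rw [hk j hj]; omega⟩

/-- Disjoint supports exclude cancellation. Admissible and allowable families must have nonempty
supports, so zero functionals have to be tracked separately. -/
theorem mixedSet_ne_zero {m k : ℕ → ℕ} (hm : ∀ j, 1 ≤ j → 1 ≤ m j) {f : ℕ+ →₀ ℝ}
    (hf : f ∈ mixedSet m k) : f ≠ 0 := by
  obtain ⟨n, hn⟩ := Set.mem_iUnion.1 hf
  clear hf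
  induction n generalizing f with
  | zero =>
    obtain ⟨p, rfl | rfl⟩ := hn <;> simp
  | succ n ih =>
    rcases hn with hn | ⟨j, hj, d, g, hd, hg, hgood, rfl⟩
    · exact ih hn
    · have h0 : g ⟨0, hd⟩ ≠ 0 := ih (hg _)
      obtain ⟨a, ha⟩ := Finsupp.support_nonempty_iff.2 h0
      intro h
      have h1 := DFunLike.congr_fun h a
      have h2 : ∑ i, g i a = g ⟨0, hd⟩ a := by
        refine Finset.sum_eq_single _ (fun i _ hi => ?_) (by simp)
        by_contra h3
        exact Finset.disjoint_left.1 (hgood.disjoint i _ hi) (Finsupp.mem_support_iff.2 h3) ha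
      have h3 : (1 : ℝ) ≤ m j := by exact_mod_cast hm j hj
      simp only [Finsupp.smul_apply, Finsupp.finsetSum_apply, h2, smul_eq_mul, coe_recip,
        Finsupp.zero_apply, mul_eq_zero] at h1
      rcases h1 with h1 | h1
      · have : (0 : ℝ) < 1 / m j := by positivity
        exact this.ne' h1
      · exact (Finsupp.mem_support_iff.1 ha) h1

/-! ### Closure properties of the norming set -/

namespace GrowthData
variable {m k : ℕ → ℕ}

theorem one_le_m (P : GrowthData m k) (j : ℕ) (hj : 1 ≤ j) : 1 ≤ m j := hj.trans (P.le_m j hj)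

theorem ne_zero (P : GrowthData m k) {f : ℕ+ →₀ ℝ} (hf : f ∈ mixedSet m k) : f ≠ 0 :=
  mixedSet_ne_zero P.one_le_m hf

/-- Sums of at most `min` many disjointly supported elements of the norming set (or `0`),
multiplied by `1 / 2`, are again in the norming set. -/
theorem half_sum_mem (P : GrowthData m k) {ι : Type*} (I : Finset ι) (g : ι → (ℕ+ →₀ ℝ))
    (hg : ∀ i ∈ I, g i ∈ mixedSet m k ∨ g i = 0)
    (hdis : ∀ i ∈ I, ∀ j ∈ I, i ≠ j → Disjoint (g i).support (g j).support)
    (hcard : ∀ i ∈ I, ∀ a ∈ (g i).support, I.card ≤ (a : ℕ)) :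
    (1 / 2 : ℝ) • ∑ i ∈ I, g i ∈ mixedSet m k ∨ (1 / 2 : ℝ) • ∑ i ∈ I, g i = 0 := by
  classical
  set J := I.filter fun i => g i ≠ 0 with hJ
  have hsum : ∑ i ∈ I, g i = ∑ i ∈ J, g i := (sum_filter_ne_zero I).symm
  rw [hsum]
  rcases J.eq_empty_or_nonempty with h0 | hne
  · right; simp [h0]
  left
  let e : Fin J.card ≃ J := J.equivFin.symm
  have hmem : ∀ i, (e i : ι) ∈ I ∧ g (e i) ≠ 0 := fun i => mem_filter.1 (e i).2
  have hsum2 : ∑ i ∈ J, g i = ∑ i : Fin J.card, g (e i) := by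
    rw [← sum_coe_sort J g]
    exact (e.sum_comp fun i : J => g i).symm
  rw [hsum2]
  have h2 : (1 / 2 : ℝ) = ((recip (m 1) : unitInterval) : ℝ) := by
    rw [coe_recip, P.m_one]; norm_num
  rw [h2]
  refine smul_sum_mem_normingSet (s := 1) (M := fun j => schreier (k j))
    (θ := fun j => ((recip (m j) : unitInterval) : ℝ)) le_rfl (card_pos.2 hne)
    (fun i => (hg _ (hmem i).1).resolve_right (hmem i).2) ⟨fun _ => ⟨?_, ?_⟩, by simp⟩
  · intro i j hij
    refine hdis _ (hmem i).1 _ (hmem j).1 fun h => hij ?_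
    exact e.injective (Subtype.ext h)
  · refine ⟨fun i => Finsupp.support_nonempty_iff.2 (hmem i).2, ?_⟩
    simp only [P.k_one]
    refine mem_schreier_one fun a ha => ?_
    obtain ⟨i, -, rfl⟩ := mem_image.1 ha
    calc _ ≤ (univ : Finset (Fin J.card)).card := card_image_le
      _ = J.card := by simp
      _ ≤ I.card := card_filter_le _ _
      _ ≤ _ := hcard _ (hmem i).1 _ (min'_mem _ _)

/-- The norming set, together with `0`, is closed under restrictions. -/
theorem filter_mem (P : GrowthData m k) {f : ℕ+ →₀ ℝ} (hf : f ∈ mixedSet m k) (p : ℕ+ → Prop)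
    [DecidablePred p] : f.filter p ∈ mixedSet m k ∨ f.filter p = 0 := by
  classical
  obtain ⟨n, hn⟩ := Set.mem_iUnion.1 hf
  clear hf
  induction n generalizing f with
  | zero =>
    obtain ⟨q, rfl | rfl⟩ := hn
    · by_cases h : p q
      · left; rw [Finsupp.filter_single_of_pos _ h]; exact Set.mem_iUnion.2 ⟨0, q, Or.inl rfl⟩
      · right; rw [Finsupp.filter_single_of_neg _ h]
    · rw [← Finsupp.single_neg]
      by_cases h : p q
      · left; rw [Finsupp.filter_single_of_pos _ h]
        exact Set.mem_iUnion.2 ⟨0, q, Or.inr (by rw [Finsupp.single_neg])⟩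
      · right; rw [Finsupp.filter_single_of_neg _ h]
  | succ n ih =>
    rcases hn with hn | ⟨j, hj, d, g, hd, hg, hgood, rfl⟩
    · exact ih hn
    · have hfs : ∀ c : ℝ, (c • ∑ i, g i).filter p = c • ∑ i, (g i).filter p := by
        intro c
        ext a
        by_cases h : p a <;> simp [h]
      rw [hfs]
      have hsub : ∀ i, ((g i).filter p).support ⊆ (g i).support := fun i => by
        rw [Finsupp.support_filter]; exact filter_subset _ _
      have hdis : ∀ i i', i ≠ i' →
          Disjoint ((g i).filter p).support ((g i').filter p).support := fun i i' hii =>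
        Disjoint.mono (hsub i) (hsub i') (hgood.disjoint i i' hii)
      by_cases hj1 : j = 1
      · subst hj1
        have h2 : ((recip (m 1) : unitInterval) : ℝ) = 1 / 2 := by
          rw [coe_recip, P.m_one]; norm_num
        simp only [h2]
        refine P.half_sum_mem univ _ (fun i _ => ih (hg i)) (fun i _ i' _ => hdis i i') ?_
        intro i _ a ha
        obtain ⟨-, hne, hmem⟩ := hgood.1 le_rfl
        simp only [P.k_one] at hmem
        -- The minima of disjoint sets are distinct, so their number is `d`, and `𝓕_1` forces `d` to
        -- be at most each of them.
        have h3 := card_le_of_mem_schreier_one hmem _ (mem_image_of_mem _ (mem_univ i))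
        rw [card_image_of_injOn, card_univ] at h3
        · rw [card_univ]
          refine h3.trans ?_
          exact_mod_cast min'_le _ _ (hsub i ha)
        · intro x _ y _ hxy
          by_contra hne'
          have hx := min'_mem _ (hne x)
          have hy := min'_mem _ (hne y)
          simp only at hxy
          rw [hxy] at hx
          exact Finset.disjoint_left.1 (hgood.disjoint x y hne') hx hy
      · obtain ⟨hlt, hne, hmem⟩ := hgood.2 (by omega)
        set S := univ.filter fun i => (g i).filter p ≠ 0 with hS
        have hsum : ∑ i, (g i).filter p = ∑ i ∈ S, (g i).filter p := (sum_filter_ne_zero _).symm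
        rw [hsum]
        rcases S.eq_empty_or_nonempty with h0 | hSne
        · right; simp [h0]
        left
        let e := S.orderEmbOfFin rfl
        have he : ∀ i, (g (e i)).filter p ≠ 0 := fun i =>
          (mem_filter.1 (S.orderEmbOfFin_mem rfl i)).2
        have hsum2 : ∑ i ∈ S, (g i).filter p = ∑ i, (g (e i)).filter p := by
          conv_lhs => rw [← image_orderEmbOfFin_univ S rfl]
          rw [sum_image fun x _ y _ h => (S.orderEmbOfFin rfl).injective h]
        rw [hsum2]
        refine smul_sum_mem_normingSet (s := 1) (M := fun j => schreier (k j))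
          (θ := fun j => ((recip (m j) : unitInterval) : ℝ)) hj (card_pos.2 hSne)
          (fun i => (ih (hg _)).resolve_right (he i)) ⟨fun h => by omega, fun _ => ⟨?_, ?_⟩⟩
        · intro i i' hii a ha b hb
          exact hlt _ _ ((S.orderEmbOfFin rfl).strictMono hii) a (hsub _ ha) b (hsub _ hb)
        · have hne' : ∀ i, ((g (e i)).filter p).support.Nonempty := fun i =>
            Finsupp.support_nonempty_iff.2 (he i)
          refine ⟨hne', ?_⟩
          -- The surviving indices are a subset of the old ones, and each minimum can only have
          -- grown.
          refine schreier_image hmem univ (fun i => (g (e i)).support.min' (hne _)) _ ?_ ?_ ?_ ?_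
          · intro i _
            exact mem_image_of_mem (fun i => (g i).support.min' (hne i)) (mem_univ (e i))
          · intro i _ i' _ hii
            exact hlt _ _ ((S.orderEmbOfFin rfl).strictMono hii) _ (min'_mem _ _) _ (min'_mem _ _)
          · intro i _ i' _ hii
            exact hlt _ _ ((S.orderEmbOfFin rfl).strictMono hii) _ (hsub _ (min'_mem _ _)) _
              (hsub _ (min'_mem _ _))
          · intro i _
            exact min'_le _ _ (hsub _ (min'_mem _ _))

end GrowthData

/-! ### The pairing and the norm -/

theorem pairing_eq_sum_of_subset {x f : ℕ+ →₀ ℝ} {S : Finset ℕ+} (h : x.support ⊆ S) :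
    pairing x f = ∑ n ∈ S, x n * f n :=
  Finset.sum_subset h fun n _ hn => by simp [Finsupp.notMem_support_iff.1 hn]

theorem pairing_sum_left {ι : Type*} (I : Finset ι) (x : ι → (ℕ+ →₀ ℝ)) (f : ℕ+ →₀ ℝ) :
    pairing (∑ i ∈ I, x i) f = ∑ i ∈ I, pairing (x i) f := by
  classical
  induction I using Finset.induction_on with
  | empty => simp [pairing]
  | insert i I hi ih => rw [sum_insert hi, sum_insert hi, pairing_add, ih]

theorem pairing_sum_right {ι : Type*} (I : Finset ι) (x : ℕ+ →₀ ℝ) (f : ι → (ℕ+ →₀ ℝ)) :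
    pairing x (∑ i ∈ I, f i) = ∑ i ∈ I, pairing x (f i) := by
  simp only [pairing, Finsupp.sum, Finsupp.finsetSum_apply, mul_sum]
  exact sum_comm

theorem pairing_smul_right (c : ℝ) (x f : ℕ+ →₀ ℝ) : pairing x (c • f) = c * pairing x f := by
  simp only [pairing, Finsupp.sum, Finsupp.smul_apply, smul_eq_mul, mul_sum]
  exact sum_congr rfl fun n _ => by ring

theorem pairing_congr_right {x f g : ℕ+ →₀ ℝ} (h : ∀ n ∈ x.support, f n = g n) :
    pairing x f = pairing x g :=
  sum_congr rfl fun n hn => by simp only [h n hn]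

theorem pairing_zero_right (x : ℕ+ →₀ ℝ) : pairing x 0 = 0 := by simp [pairing]

theorem pairing_eq_zero_of_disjoint {x f : ℕ+ →₀ ℝ} (h : Disjoint x.support f.support) :
    pairing x f = 0 := by
  rw [pairing_congr_right (g := 0), pairing_zero_right]
  intro n hn
  simpa using Finset.disjoint_left.1 h hn

theorem recip_mem (m : ℕ → ℕ) (j : ℕ) :
    0 ≤ ((recip (m j) : unitInterval) : ℝ) ∧ ((recip (m j) : unitInterval) : ℝ) ≤ 1 :=
  ⟨(recip (m j)).2.1, (recip (m j)).2.2⟩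

section Norm
variable {m k : ℕ → ℕ}

theorem abs_pairing_le {x f : ℕ+ →₀ ℝ} (hf : f ∈ mixedSet m k) :
    |pairing x f| ≤ mixedNorm m k x :=
  pairing_le_norm (recip_mem m) x hf

theorem mixedNorm_nonneg (x : ℕ+ →₀ ℝ) : 0 ≤ mixedNorm m k x :=
  (abs_nonneg _).trans (abs_pairing_le (single_mem_normingSet _ _ _ 1))

theorem pairing_le_mixedNorm {x f : ℕ+ →₀ ℝ} (hf : f ∈ mixedSet m k ∨ f = 0) :
    pairing x f ≤ mixedNorm m k x := by
  rcases hf with hf | rfl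
  · exact (le_abs_self _).trans (abs_pairing_le hf)
  · rw [pairing_zero_right]; exact mixedNorm_nonneg x

theorem mixedNorm_le {x : ℕ+ →₀ ℝ} {c : ℝ} (h : ∀ f ∈ mixedSet m k, pairing x f ≤ c) :
    mixedNorm m k x ≤ c :=
  norm_le_of_pairing x h

theorem mixedNorm_smul (c : ℝ) (x : ℕ+ →₀ ℝ) :
    mixedNorm m k (c • x) = |c| * mixedNorm m k x :=
  norm_smul c (show PreTsirelson 1 (fun j => schreier (k j)) (fun j => recip (m j)) from x)

theorem mixedNorm_pos {x : ℕ+ →₀ ℝ} (hx : x ≠ 0) : 0 < mixedNorm m k x :=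
  norm_pos_iff.2 (show (show PreTsirelson 1 (fun j => schreier (k j)) (fun j => recip (m j))
    from x) ≠ 0 from hx)

theorem exists_pairing_gt {x : ℕ+ →₀ ℝ} {c : ℝ} (h : c < mixedNorm m k x) :
    ∃ f ∈ mixedSet m k, c < pairing x f := by
  by_contra! hc
  exact h.not_ge (mixedNorm_le hc)

end Norm

/-! ### The last operation in the construction of an element of the norming set -/

/-- `f` is half the sum of an allowable family. -/
def IsHalfSum (m k : ℕ → ℕ) (f : ℕ+ →₀ ℝ) : Prop :=
  ∃ (d : ℕ) (g : Fin d → (ℕ+ →₀ ℝ)), (∀ i, g i ∈ mixedSet m k) ∧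
    (∀ i j, i ≠ j → Disjoint (g i).support (g j).support) ∧
    (∀ i, ∀ a ∈ (g i).support, d ≤ (a : ℕ)) ∧ f = (1 / 2 : ℝ) • ∑ i, g i

/-- `f` is `1 / m s` times the sum of a successive family whose supports start in points
of `A`. -/
def HasWeight (m k : ℕ → ℕ) (s : ℕ) (A : Finset ℕ+) (f : ℕ+ →₀ ℝ) : Prop :=
  ∃ (d : ℕ) (g : Fin d → (ℕ+ →₀ ℝ)), (∀ i, g i ∈ mixedSet m k) ∧
    (∀ i j, i < j → SetLT (g i).support (g j).support) ∧
    (∀ i, minSupp (g i) ∈ A) ∧ f = (1 / (m s : ℝ)) • ∑ i, g i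

namespace GrowthData
variable {m k : ℕ → ℕ}

/-- The case distinction on which all norm estimates rest. For `j = 1` only disjointness and the
bound `d ≤ min` are kept, for `j ≥ 2` only the set of starting points. -/
theorem cases_mem (P : GrowthData m k) {f : ℕ+ →₀ ℝ} (hf : f ∈ mixedSet m k) :
    (∃ p, f.support = {p}) ∨ IsHalfSum m k f ∨
      ∃ s, 2 ≤ s ∧ ∃ A ∈ schreier (k s), HasWeight m k s A f := by
  obtain ⟨n, hn⟩ := Set.mem_iUnion.1 hf
  clear hf
  induction n generalizing f with
  | zero =>
    left
    obtain ⟨p, rfl | rfl⟩ := hn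
    · exact ⟨p, Finsupp.support_single _ one_ne_zero⟩
    · exact ⟨p, by rw [Finsupp.support_neg, Finsupp.support_single _ one_ne_zero]⟩
  | succ n ih =>
    rcases hn with hn | ⟨j, hj, d, g, hd, hg, hgood, rfl⟩
    · exact ih hn
    · right
      have hgK : ∀ i, g i ∈ mixedSet m k := fun i => Set.mem_iUnion.2 ⟨n, hg i⟩
      by_cases hj1 : j = 1
      · left
        subst hj1
        refine ⟨d, g, hgK, hgood.disjoint, fun i a ha => ?_, ?_⟩
        · obtain ⟨-, hne, hmem⟩ := hgood.1 le_rfl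
          simp only [P.k_one] at hmem
          have h3 := card_le_of_mem_schreier_one hmem _ (mem_image_of_mem _ (mem_univ i))
          rw [card_image_of_injOn, card_univ, Fintype.card_fin] at h3
          · refine h3.trans ?_
            exact_mod_cast min'_le _ _ ha
          · intro x _ y _ hxy
            by_contra hne'
            have hx := min'_mem _ (hne x)
            have hy := min'_mem _ (hne y)
            simp only at hxy
            rw [hxy] at hx
            exact Finset.disjoint_left.1 (hgood.disjoint x y hne') hx hy
        · simp only [coe_recip, P.m_one, Nat.cast_ofNat]
      · right
        obtain ⟨hlt, hne, hmem⟩ := hgood.2 (by omega)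
        refine ⟨j, by omega, _, hmem, d, g, hgK, hlt, fun i => ?_, rfl⟩
        rw [minSupp_eq (hne i)]
        exact mem_image_of_mem (fun i => (g i).support.min' (hne i)) (mem_univ i)

/-- If two successive pieces met `x`, the starting point of the later one would lie between two
points of the support of `x`, hence in `(a, b]`, contrary to `hA`. So at most one piece acts on `x`.
-/
theorem exists_unsplit (P : GrowthData m k) {s : ℕ} (hs : 1 ≤ s) {A : Finset ℕ+} {f : ℕ+ →₀ ℝ}
    (hf : HasWeight m k s A f) {x : ℕ+ →₀ ℝ} {a b : ℕ}
    (hx : ∀ p ∈ x.support, a < (p : ℕ) ∧ (p : ℕ) ≤ b)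
    (hA : ∀ p ∈ A, ¬(a < (p : ℕ) ∧ (p : ℕ) ≤ b)) :
    ∃ g, (g ∈ mixedSet m k ∨ g = 0) ∧ g.support ⊆ f.support ∧
      pairing x f = 1 / (m s : ℝ) * pairing x g := by
  obtain ⟨d, g, hg, hlt, hmin, rfl⟩ := hf
  have hdis : ∀ i j, i ≠ j → Disjoint (g i).support (g j).support := by
    intro i j hij
    rw [Finset.disjoint_left]
    intro q hi hj
    rcases lt_or_gt_of_ne hij with h | h
    · exact lt_irrefl q (hlt i j h q hi q hj)
    · exact lt_irrefl q (hlt j i h q hj q hi)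
  by_cases h : ∃ i, ¬Disjoint x.support (g i).support
  · obtain ⟨i, hi⟩ := h
    obtain ⟨q, hqx, hqi⟩ := Finset.not_disjoint_iff.1 hi
    have key : ∀ i i', i < i' → ∀ q ∈ x.support, ∀ q' ∈ x.support, q ∈ (g i).support →
        q' ∈ (g i').support → False := by
      intro i i' hii q hq q' hq' hqi hqi'
      have h0 := minSupp_mem (P.ne_zero (hg i'))
      refine hA _ (hmin i') ⟨(hx q hq).1.trans ?_, le_trans ?_ (hx q' hq').2⟩
      · exact_mod_cast hlt i i' hii q hqi _ h0
      · exact_mod_cast minSupp_le hqi'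
    refine ⟨g i, Or.inl (hg i), ?_, ?_⟩
    · intro p hp
      have h1 : ∑ j, g j p = g i p := by
        refine Finset.sum_eq_single _ (fun j _ hj => ?_) (by simp)
        by_contra h3
        exact Finset.disjoint_left.1 (hdis j _ hj) (Finsupp.mem_support_iff.2 h3) hp
      have h2 : (m s : ℝ) ≠ 0 := by have := P.one_le_m s hs; positivity
      simp only [Finsupp.mem_support_iff, Finsupp.smul_apply, Finsupp.finsetSum_apply, h1,
        smul_eq_mul] at hp ⊢
      positivity
    · rw [pairing_smul_right, pairing_sum_right]
      congr 1
      refine Finset.sum_eq_single _ (fun j _ hj => ?_) (by simp)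
      apply pairing_eq_zero_of_disjoint
      rw [Finset.disjoint_left]
      intro q' hq'x hq'j
      rcases lt_or_gt_of_ne hj with h | h
      · exact key j i h q' hq'x q hqx hq'j hqi
      · exact key i j h q hqx q' hq'x hqi hq'j
  · push Not at h
    refine ⟨0, Or.inr rfl, by simp, ?_⟩
    rw [pairing_smul_right, pairing_sum_right, pairing_zero_right]
    simp [pairing_eq_zero_of_disjoint (h _)]

/-- Terms with negative pairing are dropped and the coefficients of the others raised to `θ`. Cut
off to the points beyond `a`, at most `a + 1` disjoint functionals form an allowable family, so half
their sum is in the norming set or is `0`. -/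
theorem half_sum_pairing_le (P : GrowthData m k) {ι : Type*} (J : Finset ι)
    (g : ι → (ℕ+ →₀ ℝ)) (c : ι → ℝ) {θ : ℝ} (hc : ∀ i ∈ J, 0 ≤ c i ∧ c i ≤ θ) (hθ : 0 ≤ θ)
    (hg : ∀ i ∈ J, g i ∈ mixedSet m k ∨ g i = 0)
    (hdis : ∀ i ∈ J, ∀ j ∈ J, i ≠ j → Disjoint (g i).support (g j).support)
    {x : ℕ+ →₀ ℝ} {a : ℕ} (hx : ∀ p ∈ x.support, a < (p : ℕ)) (hJ : J.card ≤ a + 1) :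
    1 / 2 * ∑ i ∈ J, c i * pairing x (g i) ≤ θ * mixedNorm m k x := by
  classical
  set I := J.filter fun i => 0 ≤ pairing x (g i) with hI
  have h1 : ∑ i ∈ J, c i * pairing x (g i) ≤ ∑ i ∈ I, θ * pairing x (g i) := by
    rw [hI, sum_filter]
    refine sum_le_sum fun i hi => ?_
    split_ifs with h
    · exact mul_le_mul_of_nonneg_right (hc i hi).2 h
    · exact mul_nonpos_of_nonneg_of_nonpos (hc i hi).1 (not_le.1 h).le
  have hIJ : ∀ i ∈ I, i ∈ J := fun i hi => (mem_filter.1 hi).1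
  let g' : ι → (ℕ+ →₀ ℝ) := fun i => (g i).filter fun p => a < (p : ℕ)
  have hsub : ∀ i, (g' i).support ⊆ (g i).support := fun i => by
    simp only [g', Finsupp.support_filter]; exact filter_subset _ _
  have h2 := P.half_sum_mem I g' (fun i hi => ?_) (fun i hi j hj hij =>
    Disjoint.mono (hsub i) (hsub j) (hdis i (hIJ i hi) j (hIJ j hj) hij)) (fun i hi p hp => ?_)
  · have h3 := pairing_le_mixedNorm (x := x) h2
    rw [pairing_smul_right, pairing_sum_right] at h3
    have h4 : ∀ i, pairing x (g' i) = pairing x (g i) := fun i =>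
      pairing_congr_right fun p hp => Finsupp.filter_apply_pos _ _ (hx p hp)
    simp only [h4] at h3
    calc 1 / 2 * ∑ i ∈ J, c i * pairing x (g i) ≤ 1 / 2 * ∑ i ∈ I, θ * pairing x (g i) := by
          gcongr
      _ = θ * (1 / 2 * ∑ i ∈ I, pairing x (g i)) := by rw [← mul_sum]; ring
      _ ≤ _ := mul_le_mul_of_nonneg_left h3 hθ
  · rcases hg i (hIJ i hi) with h | h
    · exact P.filter_mem h _
    · right; simp only [g', h]; exact Finsupp.filter_zero _
  · simp only [g', Finsupp.support_filter, mem_filter] at hp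
    exact ((card_le_card (filter_subset _ _)).trans hJ).trans hp.2

end GrowthData

/-! ### Sums of admissible families -/

/-- Sums of `𝓕_n`-admissible families of elements of the norming set. -/
def admissibleSums (m k : ℕ → ℕ) : ℕ → Set (ℕ+ →₀ ℝ)
  | 0 => mixedSet m k
  | n + 1 => {h | ∃ (d : ℕ) (g : Fin d → (ℕ+ →₀ ℝ)), 0 < d ∧
      (∀ i, g i ∈ admissibleSums m k n) ∧ (∀ i j, i < j → SetLT (g i).support (g j).support) ∧
      (∀ i, ∀ a ∈ (g i).support, d ≤ (a : ℕ)) ∧ h = ∑ i, g i}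

theorem support_sum_of_successive {d : ℕ} {g : Fin d → (ℕ+ →₀ ℝ)}
    (h : ∀ i j, i < j → SetLT (g i).support (g j).support) :
    (∑ i, g i).support = univ.biUnion fun i => (g i).support := by
  refine Finsupp.support_sum_eq_biUnion _ fun i j hij => ?_
  rw [Finset.disjoint_left]
  intro q hi hj
  rcases lt_or_gt_of_ne hij with h' | h'
  · exact lt_irrefl q (h i j h' q hi q hj)
  · exact lt_irrefl q (h j i h' q hj q hi)

namespace GrowthData
variable {m k : ℕ → ℕ}

/-- The tree of nested sums is flattened into one successive list; the nesting of depth `n` is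
exactly what places the minima in `𝓕_n`. -/
theorem exists_list_of_mem_admissibleSums (P : GrowthData m k) {n : ℕ} {h : ℕ+ →₀ ℝ}
    (hh : h ∈ admissibleSums m k n) :
    ∃ l : List (ℕ+ →₀ ℝ), l ≠ [] ∧ (∀ g ∈ l, g ∈ mixedSet m k ∧ g.support ⊆ h.support) ∧
      l.Pairwise (fun f g => SetLT f.support g.support) ∧ l.sum = h ∧
      (l.map minSupp).toFinset ∈ schreier n := by
  induction n generalizing h with
  | zero => exact ⟨[h], by simp, fun g hg => by rw [List.mem_singleton.1 hg]; exact ⟨hh, Subset.rfl⟩, by simp, by simp, Or.inr ⟨minSupp h, by simp⟩⟩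
  | succ n ih =>
    obtain ⟨d, g, hd, hg, hlt, hmin, rfl⟩ := hh
    choose l hne hmem hpw hsum hsch using fun i => ih (hg i)
    have hsub : ∀ i, (g i).support ⊆ (∑ i, g i).support := fun i => by
      rw [support_sum_of_successive hlt]
      exact subset_biUnion_of_mem (fun i => (g i).support) (mem_univ i)
    refine ⟨(List.ofFn l).flatten, ?_, ?_, ?_, ?_, ?_⟩
    · intro h0
      rw [List.flatten_eq_nil_iff] at h0
      exact hne ⟨0, hd⟩ (h0 _ (List.mem_ofFn.2 ⟨_, rfl⟩))
    · intro f hf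
      obtain ⟨l', hl', hf'⟩ := List.mem_flatten.1 hf
      obtain ⟨i, rfl⟩ := List.mem_ofFn.1 hl'
      exact ⟨(hmem i f hf').1, (hmem i f hf').2.trans (hsub i)⟩
    · rw [List.pairwise_flatten]
      constructor
      · intro l' hl'
        obtain ⟨i, rfl⟩ := List.mem_ofFn.1 hl'
        exact hpw i
      · rw [List.pairwise_ofFn]
        intro i j hij x hx y hy a ha b hb
        exact hlt i j hij a ((hmem i x hx).2 ha) b ((hmem j y hy).2 hb)
    · rw [List.sum_flatten, List.map_ofFn, List.sum_ofFn]
      exact sum_congr rfl fun i _ => hsum i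
    · have hms : ∀ i, ∀ a ∈ ((l i).map minSupp).toFinset, a ∈ (g i).support := by
        intro i a ha
        simp only [List.mem_toFinset, List.mem_map] at ha
        obtain ⟨f, hf, rfl⟩ := ha
        exact (hmem i f hf).2 (minSupp_mem (P.ne_zero (hmem i f hf).1))
      refine Or.inr ⟨d, fun i => ((l i).map minSupp).toFinset, hsch,
        fun i a ha => hmin i a (hms i a ha),
        fun i j hij a ha b hb => hlt i j hij a (hms i a ha) b (hms j b hb), ?_⟩
      ext a
      simp only [List.mem_toFinset, List.mem_map, List.mem_flatten, List.mem_ofFn, mem_biUnion,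
        mem_univ, true_and]
      constructor
      · rintro ⟨f, ⟨_, ⟨i, rfl⟩, hf⟩, rfl⟩
        exact ⟨i, f, hf, rfl⟩
      · rintro ⟨i, f, hf, rfl⟩
        exact ⟨f, ⟨_, ⟨i, rfl⟩, hf⟩, rfl⟩

theorem smul_mem_of_admissibleSums (P : GrowthData m k) {n j : ℕ} (hj : 2 ≤ j) (hn : n ≤ k j)
    {h : ℕ+ →₀ ℝ} (hh : h ∈ admissibleSums m k n) :
    (1 / (m j : ℝ)) • h ∈ mixedSet m k ∧
      ∃ A ∈ schreier (k j), HasWeight m k j A ((1 / (m j : ℝ)) • h) := by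
  obtain ⟨l, hne, hmem, hpw, rfl, hsch⟩ := P.exists_list_of_mem_admissibleSums hh
  have hsum : l.sum = ∑ i : Fin l.length, l.get i := by
    rw [← List.sum_ofFn, List.ofFn_get]
  have hlt : ∀ i i' : Fin l.length, i < i' → SetLT (l.get i).support (l.get i').support :=
    fun i i' hii => List.pairwise_iff_get.1 hpw i i' hii
  have hK : ∀ i, l.get i ∈ mixedSet m k := fun i => (hmem _ (List.get_mem _ _)).1
  have hsch' := schreier_mono hn hsch
  constructor
  · rw [hsum]
    refine smul_sum_mem_normingSet (s := 1) (M := fun j => schreier (k j))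
      (θ := fun j => ((recip (m j) : unitInterval) : ℝ)) (by omega) (List.length_pos_iff.2 hne) hK
      ⟨fun h => by omega, fun _ => ⟨hlt, fun i =>
        Finsupp.support_nonempty_iff.2 (P.ne_zero (hK i)), ?_⟩⟩
    convert! hsch' using 1
    ext a
    simp only [mem_image, mem_univ, true_and, List.mem_toFinset, List.mem_map]
    constructor
    · rintro ⟨i, rfl⟩
      exact ⟨l.get i, List.get_mem _ _,
        minSupp_eq (Finsupp.support_nonempty_iff.2 (P.ne_zero (hK i)))⟩
    · rintro ⟨f, hf, rfl⟩
      obtain ⟨i, rfl⟩ := List.get_of_mem hf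
      exact ⟨i, (minSupp_eq (Finsupp.support_nonempty_iff.2 (P.ne_zero (hK i)))).symm⟩
  · refine ⟨_, hsch', l.length, l.get, hK, hlt, fun i => ?_, by rw [hsum]⟩
    rw [List.mem_toFinset]
    exact List.mem_map_of_mem (List.get_mem _ _)

end GrowthData

/-! ### Averages that are small on Schreier sets -/

/-- The indices `l ∈ F` for which `A` meets the interval `(P l, P (l + 1)]`. -/
def marked (P : ℕ → ℕ) (F : Finset ℕ) (A : Finset ℕ+) : Finset ℕ :=
  F.filter fun l => ∃ p ∈ A, P l < (p : ℕ) ∧ (p : ℕ) ≤ P (l + 1)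

theorem eq_of_mem_intervals {P : ℕ → ℕ} (hP : StrictMono P) {l l' p : ℕ}
    (h : P l < p ∧ p ≤ P (l + 1)) (h' : P l' < p ∧ p ≤ P (l' + 1)) : l = l' := by
  have h1 : l < l' + 1 := hP.lt_iff_lt.1 (h.1.trans_le h'.2)
  have h2 : l' < l + 1 := hP.lt_iff_lt.1 (h'.1.trans_le h.2)
  omega

/-- The conclusion of `exists_average`: the weights `a` on `F` form a convex combination, small on
`𝓕_n`-sets, with an `𝓕_(n+1)`-admissible index set. -/
structure IsAverage (m k : ℕ → ℕ) (n : ℕ) (P : ℕ → ℕ) (ε : ℝ) (L : ℕ) (F : Finset ℕ)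
    (a : ℕ → ℝ) : Prop where
  le : ∀ l ∈ F, L ≤ l
  nonneg : ∀ l, 0 ≤ a l
  sum_eq : ∑ l ∈ F, a l = 1
  small : ∀ A ∈ looseSchreier n, ∑ l ∈ marked P F A, a l ≤ ε
  sum_mem : ∀ (q : ℕ) (h : ℕ → (ℕ+ →₀ ℝ)), (∀ l ∈ F, h l ∈ admissibleSums m k q) →
    (∀ l ∈ F, ∀ p ∈ (h l).support, P l < (p : ℕ) ∧ (p : ℕ) ≤ P (l + 1)) →
    ∑ l ∈ F, h l ∈ admissibleSums m k (q + n + 1)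

theorem exists_average_zero (m k : ℕ → ℕ) {P : ℕ → ℕ} (hP : StrictMono P) {ε : ℝ} (hε : 0 < ε)
    (L : ℕ) : ∃ F a, IsAverage m k 0 P ε L F a := by
  obtain ⟨d, hd⟩ := exists_nat_gt (1 / ε)
  have hd0 : (0 : ℝ) < d := lt_trans (by positivity) hd
  have hd0' : 0 < d := by exact_mod_cast hd0
  have hdε : 1 / (d : ℝ) ≤ ε := by
    rw [div_le_iff₀ hd0]; rw [div_lt_iff₀ hε] at hd; nlinarith
  refine ⟨Ico (max L d) (max L d + d), fun _ => 1 / d, ?_, fun _ => by positivity, ?_, ?_, ?_⟩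
  · intro l hl
    exact (le_max_left _ _).trans (mem_Ico.1 hl).1
  · simp [hd0.ne']
  · intro A hA
    have : (marked P (Ico (max L d) (max L d + d)) A).card ≤ 1 := by
      rw [card_le_one]
      intro l hl l' hl'
      obtain ⟨-, p, hp, h1⟩ := mem_filter.1 hl
      obtain ⟨-, p', hp', h2⟩ := mem_filter.1 hl'
      have : p = p' := card_le_one.1 hA _ hp _ hp'
      subst this
      exact eq_of_mem_intervals hP h1 h2
    rw [sum_const, nsmul_eq_mul]
    calc _ ≤ (1 : ℝ) * (1 / d) := by gcongr; exact_mod_cast this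
      _ ≤ ε := by rwa [one_mul]
  · intro q h hh hI
    have hmem : ∀ i : Fin d, max L d + i ∈ Ico (max L d) (max L d + d) := fun i => by
      rw [mem_Ico]; omega
    refine ⟨d, fun i => h (max L d + i), hd0', fun i => hh _ (hmem i), ?_, ?_, ?_⟩
    -- The index set begins at or after `d` and `P l ≥ l`, so the `d` summands are successive and
    -- start beyond `d`.
    · intro i j hij a ha b hb
      have h1 := (hI _ (hmem i) a ha).2
      have h2 := (hI _ (hmem j) b hb).1
      have h3 : P (max L d + i + 1) ≤ P (max L d + j) := hP.monotone (by omega)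
      have : (a : ℕ) < b := by omega
      exact_mod_cast this
    · intro i a ha
      have h1 := (hI _ (hmem i) a ha).1
      have h2 := hP.le_apply (x := max L d + i)
      have h3 := le_max_right L d
      omega
    · rw [sum_Ico_eq_sum_range, Nat.add_sub_cancel_left]
      exact (Fin.sum_univ_eq_sum_range (fun i => h (max L d + i)) d).symm

theorem sum_marked_biUnion_le {P : ℕ → ℕ} {F : Finset ℕ} {a : ℕ → ℝ} (ha : ∀ l, 0 ≤ a l)
    {ι : Type*} (I : Finset ι) {A : Finset ℕ+} {B : ι → Finset ℕ+} (hA : A ⊆ I.biUnion B) :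
    ∑ l ∈ marked P F A, a l ≤ ∑ i ∈ I, ∑ l ∈ marked P F (B i), a l := by
  classical
  have hsub : marked P F A ⊆ I.biUnion fun i => marked P F (B i) := by
    intro l hl
    obtain ⟨hl, p, hp, h⟩ := mem_filter.1 hl
    obtain ⟨i, hi, hpi⟩ := mem_biUnion.1 (hA hp)
    exact mem_biUnion.2 ⟨i, hi, mem_filter.2 ⟨hl, p, hpi, h⟩⟩
  refine (sum_le_sum_of_subset_of_nonneg hsub fun l _ _ => ha l).trans ?_
  clear hsub hA
  induction I using Finset.induction_on with
  | empty => simp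
  | insert i I hi ih =>
    rw [biUnion_insert, sum_insert hi]
    have h1 := sum_union_inter (s₁ := marked P F (B i)) (s₂ := I.biUnion fun i => marked P F (B i))
      (f := a)
    have h2 : 0 ≤ ∑ l ∈ marked P F (B i) ∩ I.biUnion fun i => marked P F (B i), a l :=
      sum_nonneg fun l _ => ha l
    linarith

/-- The average of level `n + 1` is the uniform mean of `d` successive averages of level `n`, each
much finer than the position at which it starts. A set in the loose family of level `n + 1` is
covered by `e` sets of level `n`, with `e` at most its minimum. The first average it meets costs at
most `1 / d`; on every later one `e` is bounded by the starting position, so that mass is at most `ε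
/ 2`. -/
theorem exists_average (m k : ℕ → ℕ) (n : ℕ) {P : ℕ → ℕ} (hP : StrictMono P) {ε : ℝ} (hε : 0 < ε)
    (L : ℕ) : ∃ F a, IsAverage m k n P ε L F a := by
  classical
  induction n generalizing ε L with
  | zero => exact exists_average_zero m k hP hε L
  | succ n ih =>
    obtain ⟨d, hd⟩ := exists_nat_gt (2 / ε)
    have hd0 : (0 : ℝ) < d := lt_trans (by positivity) hd
    have hd0' : 0 < d := by exact_mod_cast hd0
    have hdε : 1 / (d : ℝ) ≤ ε / 2 := by
      rw [div_lt_iff₀ hε] at hd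
      rw [div_le_iff₀ hd0]; nlinarith
    have hpos : ∀ L', 0 < ε / (2 * ((P L' : ℝ) + 1)) := fun L' => by positivity
    choose F a hF using fun L' => ih (hpos L') L'
    -- `S i` is the lower bound for the indices of the `i`-th average, chosen beyond all indices of
    -- the previous one.
    let S : ℕ → ℕ := fun i => Nat.rec (max L d) (fun _ L' => max (L' + 1) ((F L').sup id + 1)) i
    have hS1 : ∀ i, S (i + 1) = max (S i + 1) ((F (S i)).sup id + 1) := fun i => rfl
    have hSm : StrictMono S := strictMono_nat_of_lt_succ fun i => by
      rw [hS1]; exact lt_of_lt_of_le (Nat.lt_succ_self _) (le_max_left _ _)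
    have hS0 : ∀ i, max L d ≤ S i := fun i => hSm.monotone (Nat.zero_le i)
    have hub : ∀ i j, i < j → ∀ l ∈ F (S i), l + 1 ≤ S j := by
      intro i j hij l hl
      have h1 : l ≤ (F (S i)).sup id := le_sup (f := id) hl
      have h2 : S (i + 1) ≤ S j := hSm.monotone hij
      have h3 : (F (S i)).sup id + 1 ≤ S (i + 1) := le_max_right _ _
      omega
    have hlow : ∀ i, ∀ l ∈ F (S i), S i ≤ l := fun i => (hF (S i)).le
    have huniq : ∀ i j l, l ∈ F (S i) → l ∈ F (S j) → i = j := by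
      intro i j l hi hj
      rcases lt_trichotomy i j with h | h | h
      · have := hub i j h l hi; have := hlow j l hj; omega
      · exact h
      · have := hub j i h l hj; have := hlow i l hi; omega
    set G : Finset ℕ := univ.biUnion fun i : Fin d => F (S i) with hG
    let b : ℕ → ℝ := fun l => 1 / (d : ℝ) * ∑ i : Fin d, if l ∈ F (S i) then a (S i) l else 0
    have hb : ∀ i : Fin d, ∀ l ∈ F (S i), b l = 1 / (d : ℝ) * a (S i) l := by
      intro i l hl
      simp only [b]
      congr 1
      rw [Finset.sum_eq_single i]
      · rw [if_pos hl]
      · intro j _ hj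
        rw [if_neg]
        intro hlj
        exact hj (Fin.ext (huniq _ _ l hlj hl))
      · simp
    have hdisj : (Set.univ : Set (Fin d)).PairwiseDisjoint fun i => F (S i) := by
      intro i _ j _ hij
      rw [Function.onFun, Finset.disjoint_left]
      intro l hi hj
      exact hij (Fin.ext (huniq _ _ l hi hj))
    have hd1 : ((univ : Finset (Fin d)) : Set (Fin d)).PairwiseDisjoint fun i => F (S i) := by
      simpa using hdisj
    refine ⟨G, b, ?_, ?_, ?_, ?_, ?_⟩
    · intro l hl
      obtain ⟨i, -, hi⟩ := mem_biUnion.1 hl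
      exact (le_max_left L d).trans ((hS0 i).trans (hlow i l hi))
    · intro l
      refine mul_nonneg (by positivity) (sum_nonneg fun i _ => ?_)
      split_ifs
      · exact (hF _).nonneg l
      · exact le_rfl
    · rw [hG, sum_biUnion hd1, sum_congr rfl fun i _ => sum_congr rfl (hb i)]
      simp only [← mul_sum, (hF _).sum_eq]
      simp [hd0.ne']
    · intro A hA
      obtain ⟨e, B, hB, heA, hAB⟩ := hA
      let v : ℕ → ℝ := fun i => ∑ l ∈ marked P (F (S i)) A, a (S i) l
      have hmG : marked P G A = univ.biUnion fun i : Fin d => marked P (F (S i)) A := by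
        rw [hG, marked, filter_biUnion]; rfl
      have hsum : ∑ l ∈ marked P G A, b l = 1 / (d : ℝ) * ∑ i : Fin d, v i := by
        rw [hmG, sum_biUnion, mul_sum]
        · refine sum_congr rfl fun i _ => ?_
          rw [mul_sum]
          exact sum_congr rfl fun l hl => hb i l (mem_filter.1 hl).1
        · intro i _ j _ hij
          exact Disjoint.mono (filter_subset _ _) (filter_subset _ _)
            (hdisj (Set.mem_univ i) (Set.mem_univ j) hij)
      have hv1 : ∀ i, v i ≤ 1 := fun i => by
        rw [← (hF (S i)).sum_eq]
        exact sum_le_sum_of_subset_of_nonneg (filter_subset _ _) fun l _ _ => (hF _).nonneg l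
      -- A point of `A` in the earlier average `i` bounds `e` by `P (S j)`, and the tolerance of
      -- average `j` was divided by `2 (P (S j) + 1)`.
      have hv2 : ∀ i j, i < j → (marked P (F (S i)) A).Nonempty → v j ≤ ε / 2 := by
        rintro i j hij ⟨l, hl⟩
        obtain ⟨hl, p, hp, h1, h2⟩ := mem_filter.1 hl
        have he : e ≤ P (S j) := (heA p hp).trans (h2.trans (hP.monotone (hub i j hij l hl)))
        calc v j ≤ ∑ i : Fin e, ∑ l ∈ marked P (F (S j)) (B i), a (S j) l :=
              sum_marked_biUnion_le (hF _).nonneg _ hAB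
          _ ≤ ∑ _i : Fin e, ε / (2 * ((P (S j) : ℝ) + 1)) :=
              sum_le_sum fun i _ => (hF _).small _ (hB i)
          _ = (e : ℝ) * (ε / (2 * ((P (S j) : ℝ) + 1))) := by simp
          _ ≤ ((P (S j) : ℝ) + 1) * (ε / (2 * ((P (S j) : ℝ) + 1))) := by
              have : (e : ℝ) ≤ P (S j) := by exact_mod_cast he
              gcongr
              linarith
          _ = ε / 2 := by field_simp
      rw [hsum]
      by_cases hne : ∃ i : ℕ, (marked P (F (S i)) A).Nonempty
      · have hv3 : ∀ i, v i ≤ (if i = Nat.find hne then 1 else 0) + ε / 2 := by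
          intro i
          rcases lt_trichotomy i (Nat.find hne) with h | h | h
          · have h0 : marked P (F (S i)) A = ∅ := not_nonempty_iff_eq_empty.1 (Nat.find_min hne h)
            have : v i = 0 := by simp only [v, h0, sum_empty]
            rw [this, if_neg h.ne]; positivity
          · rw [if_pos h]; linarith [hv1 i]
          · rw [if_neg h.ne', zero_add]; exact hv2 _ _ h (Nat.find_spec hne)
        have hite : ∑ i : Fin d, (if (i : ℕ) = Nat.find hne then (1 : ℝ) else 0) ≤ 1 := by
          rw [sum_boole]
          have : (univ.filter fun i : Fin d => (i : ℕ) = Nat.find hne).card ≤ 1 := by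
            rw [card_le_one]
            intro i hi j hj
            exact Fin.ext ((mem_filter.1 hi).2.trans (mem_filter.1 hj).2.symm)
          exact_mod_cast this
        calc 1 / (d : ℝ) * ∑ i : Fin d, v i
            ≤ 1 / (d : ℝ) * ∑ i : Fin d, ((if (i : ℕ) = Nat.find hne then 1 else 0) + ε / 2) := by
              gcongr with i; exact hv3 i
          _ ≤ 1 / (d : ℝ) * (1 + d * (ε / 2)) := by
              rw [sum_add_distrib]
              gcongr
              simp
          _ = 1 / (d : ℝ) + ε / 2 := by field_simp
          _ ≤ ε := by linarith
      · push Not at hne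
        have : ∀ i, v i = 0 := fun i => by simp only [v, hne i, sum_empty]
        simp only [this, sum_const_zero, mul_zero]
        exact hε.le
    · intro q h hh hI
      have hGi : ∀ i : Fin d, ∀ l ∈ F (S i), l ∈ G := fun i l hl =>
        mem_biUnion.2 ⟨i, mem_univ i, hl⟩
      have hsupp : ∀ i : Fin d, ∀ p ∈ (∑ l ∈ F (S i), h l).support,
          ∃ l ∈ F (S i), P l < (p : ℕ) ∧ (p : ℕ) ≤ P (l + 1) := by
        intro i p hp
        obtain ⟨l, hl, hp'⟩ := mem_biUnion.1 (Finsupp.support_finsetSum hp)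
        exact ⟨l, hl, hI l (hGi i l hl) p hp'⟩
      refine ⟨d, fun i => ∑ l ∈ F (S i), h l, hd0', fun i => ?_, ?_, ?_, ?_⟩
      · exact (hF (S i)).sum_mem q h (fun l hl => hh l (hGi i l hl))
          (fun l hl => hI l (hGi i l hl))
      · intro i j hij p hp p' hp'
        obtain ⟨l, hl, h1, h2⟩ := hsupp i p hp
        obtain ⟨l', hl', h3, h4⟩ := hsupp j p' hp'
        have h5 : P (l + 1) ≤ P l' := hP.monotone ((hub i j hij l hl).trans (hlow j l' hl'))
        have : (p : ℕ) < p' := by omega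
        exact_mod_cast this
      · intro i p hp
        obtain ⟨l, hl, h1, h2⟩ := hsupp i p hp
        have h3 := hP.le_apply (x := l)
        have h4 := hlow i l hl
        have h5 := hS0 i
        have h6 := le_max_right L d
        omega
      · rw [hG, sum_biUnion hd1]

/-! ### Block sequences -/

/-- Dependent choice with state: the scheme behind all sequences of blocks below, whose next term
depends on where the previous one ended. -/
theorem exists_chain {S α : Type*} {R : S → S → α → Prop} {I : S → Prop} {s₀ : S} (h₀ : I s₀)
    (h : ∀ s, I s → ∃ s' x, I s' ∧ R s s' x) :
    ∃ (st : ℕ → S) (x : ℕ → α), st 0 = s₀ ∧ ∀ i, I (st i) ∧ R (st i) (st (i + 1)) (x i) := by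
  choose nx y hI hR using h
  let st : ℕ → {s // I s} := fun i =>
    Nat.rec ⟨s₀, h₀⟩ (fun _ s => ⟨nx s.1 s.2, hI s.1 s.2⟩) i
  exact ⟨fun i => (st i).1, fun i => y (st i).1 (st i).2, rfl,
    fun i => ⟨(st i).2, hR (st i).1 (st i).2⟩⟩

theorem exists_blocks {α : Type*} (σ : α → Finset ℕ+) {φ : α → Prop} (L : ℕ)
    (h : ∀ L', L ≤ L' → ∃ x, φ x ∧ ∀ p ∈ σ x, L' < (p : ℕ)) :
    ∃ (P : ℕ → ℕ) (y : ℕ → α), StrictMono P ∧ P 0 = L ∧ (∀ l, φ (y l)) ∧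
      ∀ l, ∀ p ∈ σ (y l), P l < (p : ℕ) ∧ (p : ℕ) ≤ P (l + 1) := by
  obtain ⟨P, y, h0, hP⟩ := exists_chain (I := fun n => L ≤ n)
    (R := fun n n' x => n < n' ∧ φ x ∧ ∀ p ∈ σ x, n < (p : ℕ) ∧ (p : ℕ) ≤ n') (s₀ := L) le_rfl
    (fun n hn => by
      obtain ⟨x, hx, hσ⟩ := h n hn
      refine ⟨max (n + 1) ((σ x).sup fun p => (p : ℕ)), x, by omega, by omega, hx,
        fun p hp => ⟨hσ p hp, ?_⟩⟩
      exact le_trans (le_sup (f := fun p : ℕ+ => (p : ℕ)) hp) (le_max_right _ _))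
  exact ⟨P, y, strictMono_nat_of_lt_succ fun i => (hP i).2.1, h0, fun l => (hP l).2.2.1,
    fun l => (hP l).2.2.2⟩

/-- A subspace of `c₀₀` that contains nonzero vectors supported arbitrarily far out. -/
def TailNontrivial (U : Submodule ℝ (ℕ+ →₀ ℝ)) : Prop :=
  ∀ n : ℕ, ∃ u ∈ U, u ≠ 0 ∧ ∀ p ∈ u.support, n < (p : ℕ)

theorem disjoint_of_intervals {P : ℕ → ℕ} (hP : StrictMono P) {l l' : ℕ} (hne : l ≠ l')
    {A B : Finset ℕ+} (hA : ∀ p ∈ A, P l < (p : ℕ) ∧ (p : ℕ) ≤ P (l + 1))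
    (hB : ∀ p ∈ B, P l' < (p : ℕ) ∧ (p : ℕ) ≤ P (l' + 1)) : Disjoint A B := by
  rw [Finset.disjoint_left]
  intro p hp hp'
  exact hne (eq_of_mem_intervals hP (hA p hp) (hB p hp'))

theorem pairing_block_sums {P : ℕ → ℕ} (hP : StrictMono P) (F : Finset ℕ) (a : ℕ → ℝ)
    {w h : ℕ → (ℕ+ →₀ ℝ)}
    (hw : ∀ l, ∀ p ∈ (w l).support, P l < (p : ℕ) ∧ (p : ℕ) ≤ P (l + 1))
    (hh : ∀ l, ∀ p ∈ (h l).support, P l < (p : ℕ) ∧ (p : ℕ) ≤ P (l + 1)) :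
    pairing (∑ l ∈ F, a l • w l) (∑ l ∈ F, h l) = ∑ l ∈ F, a l * pairing (w l) (h l) := by
  rw [pairing_sum_left]
  refine sum_congr rfl fun l hl => ?_
  rw [pairing_smul, pairing_sum_right]
  congr 1
  refine Finset.sum_eq_single l (fun l' _ hne => ?_) (fun h => absurd hl h)
  exact pairing_eq_zero_of_disjoint (disjoint_of_intervals hP hne.symm (hw l) (hh l'))

theorem support_sum_smul_subset {ι : Type*} (F : Finset ι) (a : ι → ℝ) (w : ι → (ℕ+ →₀ ℝ))
    {p : ℕ+} (hp : p ∈ (∑ l ∈ F, a l • w l).support) : ∃ l ∈ F, p ∈ (w l).support := by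
  classical
  obtain ⟨l, hl, hp'⟩ := mem_biUnion.1 (Finsupp.support_finsetSum hp)
  exact ⟨l, hl, Finsupp.support_smul hp'⟩

theorem mixedNorm_normalize {m k : ℕ → ℕ} {x : ℕ+ →₀ ℝ} (hx : 0 < mixedNorm m k x) :
    mixedNorm m k ((mixedNorm m k x)⁻¹ • x) = 1 := by
  rw [mixedNorm_smul, abs_inv, abs_of_pos hx, inv_mul_cancel₀ hx.ne']

/-! ### Averages of large norm and unsplit vectors -/

namespace GrowthData
variable {m k : ℕ → ℕ}

/-- Every block subspace contains averages of normalized blocks, small on `𝓕_(k (j - 1))`-sets,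
of norm at least `1 / 2`. -/
theorem exists_large_average (G : GrowthData m k) {U : Submodule ℝ (ℕ+ →₀ ℝ)}
    (hU : TailNontrivial U) {j : ℕ} (hj : 2 ≤ j) {ε : ℝ} (hε : 0 < ε) (L : ℕ) :
    ∃ (P : ℕ → ℕ) (y : ℕ → (ℕ+ →₀ ℝ)) (F : Finset ℕ) (a : ℕ → ℝ), StrictMono P ∧ L ≤ P 0 ∧
      (∀ l, y l ∈ U ∧ mixedNorm m k (y l) = 1) ∧
      (∀ l, ∀ p ∈ (y l).support, P l < (p : ℕ) ∧ (p : ℕ) ≤ P (l + 1)) ∧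
      IsAverage m k (k (j - 1)) P ε 0 F a ∧ 1 / 2 ≤ mixedNorm m k (∑ l ∈ F, a l • y l) := by
  classical
  by_contra! hcon
  -- By `hcon` every average has norm below `1/2`, so renormalizing it at least doubles its pairing
  -- with the sum of the functionals, and each round costs `k (j - 1) + 1` levels of admissibility.
  have key : ∀ t : ℕ, ∀ L', L ≤ L' → ∃ wh : (ℕ+ →₀ ℝ) × (ℕ+ →₀ ℝ), (wh.1 ∈ U ∧
      mixedNorm m k wh.1 = 1 ∧ wh.2 ∈ admissibleSums m k ((k (j - 1) + 1) * t) ∧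
      3 / 4 * 2 ^ t ≤ pairing wh.1 wh.2) ∧ ∀ p ∈ wh.1.support ∪ wh.2.support, L' < (p : ℕ) := by
    intro t
    induction t with
    | zero =>
      intro L' _
      obtain ⟨u, huU, hu0, hu⟩ := hU L'
      have hpos := mixedNorm_pos (m := m) (k := k) hu0
      set w := (mixedNorm m k u)⁻¹ • u with hw
      have hw1 : mixedNorm m k w = 1 := mixedNorm_normalize hpos
      obtain ⟨f, hf, hfw⟩ := exists_pairing_gt (m := m) (k := k) (x := w) (c := 3 / 4)
        (by rw [hw1]; norm_num)
      have hwL : ∀ p ∈ w.support, L' < (p : ℕ) := fun p hp => hu p (Finsupp.support_smul hp)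
      -- The functional must also live beyond `L'`, so it is cut off; the positive pairing survives
      -- and shows that the cut-off functional is not zero.
      have hpair : pairing w (f.filter fun p : ℕ+ => L' < (p : ℕ)) = pairing w f :=
        pairing_congr_right fun p hp =>
          Finsupp.filter_apply_pos (fun p : ℕ+ => L' < (p : ℕ)) _ (hwL p hp)
      refine ⟨(w, f.filter fun p : ℕ+ => L' < (p : ℕ)), ⟨U.smul_mem _ huU, hw1, ?_, ?_⟩, ?_⟩
      · rcases G.filter_mem hf (fun p : ℕ+ => L' < (p : ℕ)) with h | h
        · exact h
        · rw [h, pairing_zero_right] at hpair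
          linarith
      · simp only [hpair]; linarith
      · intro p hp
        rcases mem_union.1 hp with hp | hp
        · exact hwL p hp
        · simp only [Finsupp.support_filter, mem_filter] at hp
          exact hp.2
    | succ t ih =>
      intro L' hL'
      obtain ⟨P, wh, hP, hP0, hφ, hI⟩ := exists_blocks
        (fun wh : (ℕ+ →₀ ℝ) × (ℕ+ →₀ ℝ) => wh.1.support ∪ wh.2.support) L'
        (fun L'' hL'' => ih L'' (hL'.trans hL''))
      obtain ⟨F, a, hF⟩ := exists_average m k (k (j - 1)) hP hε 0
      have hI1 : ∀ l, ∀ p ∈ (wh l).1.support, P l < (p : ℕ) ∧ (p : ℕ) ≤ P (l + 1) :=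
        fun l p hp => hI l p (mem_union_left _ hp)
      have hI2 : ∀ l, ∀ p ∈ (wh l).2.support, P l < (p : ℕ) ∧ (p : ℕ) ≤ P (l + 1) :=
        fun l p hp => hI l p (mem_union_right _ hp)
      set x := ∑ l ∈ F, a l • (wh l).1 with hx
      set h := ∑ l ∈ F, (wh l).2 with hh
      have hlt : mixedNorm m k x < 1 / 2 :=
        hcon P (fun l => (wh l).1) F a hP (hL'.trans hP0.ge) (fun l => ⟨(hφ l).1, (hφ l).2.1⟩) hI1 hF
      have hpair : 3 / 4 * 2 ^ t ≤ pairing x h := by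
        rw [hx, hh, pairing_block_sums hP F a hI1 hI2]
        calc (3 / 4 * 2 ^ t : ℝ) = ∑ l ∈ F, a l * (3 / 4 * 2 ^ t) := by
              rw [← sum_mul, hF.sum_eq, one_mul]
          _ ≤ _ := sum_le_sum fun l _ => mul_le_mul_of_nonneg_left (hφ l).2.2.2 (hF.nonneg l)
      have hx0 : x ≠ 0 := by
        rintro h0
        rw [h0] at hpair
        have : pairing 0 h = 0 := by simp [pairing]
        rw [this] at hpair
        have : (0 : ℝ) < 3 / 4 * 2 ^ t := by positivity
        linarith
      have hpos := mixedNorm_pos (m := m) (k := k) hx0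
      refine ⟨((mixedNorm m k x)⁻¹ • x, h), ⟨U.smul_mem _ (U.sum_mem fun l _ =>
        U.smul_mem _ (hφ l).1), mixedNorm_normalize hpos, ?_, ?_⟩, ?_⟩
      · have := hF.sum_mem _ _ (fun l _ => (hφ l).2.2.1) (fun l _ => hI2 l)
        rwa [show (k (j - 1) + 1) * (t + 1) = (k (j - 1) + 1) * t + k (j - 1) + 1 by ring]
      · simp only [pairing_smul]
        have h2 : 2 ≤ (mixedNorm m k x)⁻¹ := by
          rw [le_inv_comm₀ (by norm_num) hpos]; linarith
        calc (3 / 4 * 2 ^ (t + 1) : ℝ) = 2 * (3 / 4 * 2 ^ t) := by ring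
          _ ≤ (mixedNorm m k x)⁻¹ * pairing x h := by gcongr
      · intro p hp
        have hl : ∃ l, P l < (p : ℕ) := by
          rcases mem_union.1 hp with hp | hp
          · obtain ⟨l, -, hl⟩ := support_sum_smul_subset F a _ (Finsupp.support_smul hp)
            exact ⟨l, (hI1 l p hl).1⟩
          · obtain ⟨l, -, hl⟩ := mem_biUnion.1 (Finsupp.support_finsetSum hp)
            exact ⟨l, (hI2 l p hl).1⟩
        obtain ⟨l, hl⟩ := hl
        have := hP.monotone (Nat.zero_le l)
        omega
  -- The admissible sum times `1 / m j` is in the norming set and takes a value of at least `3/4 * m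
  -- j > 1` on a unit vector, a contradiction.
  obtain ⟨t, ht, htk⟩ := G.exists_iter j hj
  obtain ⟨⟨w, h⟩, ⟨-, hw, hh, hp⟩, -⟩ := key t L le_rfl
  have h1 := G.smul_mem_of_admissibleSums hj (by rw [mul_comm]; exact htk) hh
  have h2 := pairing_le_mixedNorm (x := w) (Or.inl h1.1)
  change mixedNorm m k w = 1 at hw
  rw [pairing_smul_right, hw] at h2
  have h5 : (5 : ℝ) ≤ m j := by exact_mod_cast G.five_le j hj
  have ht' : (m j : ℝ) ^ 2 ≤ 2 ^ t := by exact_mod_cast ht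
  rw [one_div, inv_mul_le_iff₀ (by linarith)] at h2
  simp only at hp
  nlinarith

/-- The vectors used to build rapidly increasing sequences: at most `N` disjoint functionals of
weights `1 / m s`, `s < j`, act on them as if they were not split. -/
theorem exists_unsplit_vector (G : GrowthData m k) {U : Submodule ℝ (ℕ+ →₀ ℝ)}
    (hU : TailNontrivial U) {j : ℕ} (hj : 2 ≤ j) {δ : ℝ} (hδ : 0 < δ) (N L : ℕ) :
    ∃ z ∈ U, mixedNorm m k z = 1 ∧ (∀ p ∈ z.support, L < (p : ℕ)) ∧
      ∀ (d : ℕ) (f : Fin d → (ℕ+ →₀ ℝ)) (J : Finset (Fin d)) (θ : ℝ), J.card ≤ N → 0 ≤ θ →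
        (∀ i ∈ J, f i ∈ mixedSet m k) →
        (∀ i ∈ J, ∀ i' ∈ J, i ≠ i' → Disjoint (f i).support (f i').support) →
        (∀ i ∈ J, ∃ s A, 2 ≤ s ∧ s < j ∧ A ∈ schreier (k s) ∧ HasWeight m k s A (f i) ∧
          1 / (m s : ℝ) ≤ θ) →
        1 / 2 * ∑ i ∈ J, pairing z (f i) ≤ 2 * θ + δ := by
  classical
  have hε : 0 < δ / (2 * ((N : ℝ) + 1)) := by positivity
  -- Blocks beyond `N` let half a sum of `N` disjoint functionals act as one element of the norming
  -- set. The tolerance `ε` is for `N` sets of starting points with total mass `δ / 2`;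
  -- normalization by `ν ≥ 1/2` doubles this to `δ`.
  obtain ⟨P, y, F, a, hP, hL, hy, hI, hF, hν⟩ := G.exists_large_average hU hj hε (max L N)
  set x := ∑ l ∈ F, a l • y l with hx
  set ν := mixedNorm m k x with hνdef
  have hν0 : 0 < ν := by linarith
  have hν2 : ν⁻¹ ≤ 2 := by rw [inv_le_comm₀ hν0 (by norm_num)]; linarith
  refine ⟨ν⁻¹ • x, U.smul_mem _ (U.sum_mem fun l _ => U.smul_mem _ (hy l).1),
    mixedNorm_normalize hν0, ?_, ?_⟩
  · intro p hp
    obtain ⟨l, -, hl⟩ := support_sum_smul_subset F a _ (Finsupp.support_smul hp)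
    have h1 := (hI l p hl).1
    have h2 := hP.monotone (Nat.zero_le l)
    have h3 := le_max_left L N
    omega
  · intro d f J θ hJ hθ hfK hdis hw
    choose! s A hs hsj hA hwt hle using hw
    have hlow : ∀ l, ∀ p ∈ (y l).support, N < (p : ℕ) := fun l p hp => by
      have h1 := (hI l p hp).1
      have h2 := hP.monotone (Nat.zero_le l)
      have h3 := le_max_right L N
      omega
    set Mk := marked P F (J.biUnion A) with hMk
    -- On a marked block the half sum is bounded by the norm `1`; on any other block no functional
    -- is split, and each keeps its factor `1 / m (s i) ≤ θ`.
    have hl : ∀ l ∈ F, 1 / 2 * ∑ i ∈ J, pairing (y l) (f i) ≤ θ + if l ∈ Mk then 1 else 0 := by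
      intro l hlF
      split_ifs with h
      · have h1 := G.half_sum_pairing_le J f (fun _ => 1) (θ := 1)
          (fun _ _ => ⟨zero_le_one, le_rfl⟩) zero_le_one (fun i hi => Or.inl (hfK i hi)) hdis
          (hlow l) (hJ.trans (Nat.le_succ N))
        simp only [one_mul, (hy l).2] at h1
        linarith
      · have hun : ∀ i ∈ J, ∃ g, (g ∈ mixedSet m k ∨ g = 0) ∧ g.support ⊆ (f i).support ∧
            pairing (y l) (f i) = 1 / (m (s i) : ℝ) * pairing (y l) g := by
          intro i hi
          refine G.exists_unsplit (by have := hs i hi; omega) (hwt i hi) (hI l) ?_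
          intro p hp hpl
          exact h (mem_filter.2 ⟨hlF, p, mem_biUnion.2 ⟨i, hi, hp⟩, hpl⟩)
        choose! g hg hgs hgp using hun
        have h1 := G.half_sum_pairing_le J g (fun i => 1 / (m (s i) : ℝ)) (θ := θ)
          (fun i hi => ⟨by positivity, hle i hi⟩) hθ hg
          (fun i hi i' hi' hne => Disjoint.mono (hgs i hi) (hgs i' hi') (hdis i hi i' hi' hne))
          (hlow l) (hJ.trans (Nat.le_succ N))
        rw [(hy l).2, mul_one, ← sum_congr rfl hgp] at h1
        linarith
    have hsmall : ∑ l ∈ Mk, a l ≤ δ / 2 := by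
      calc ∑ l ∈ Mk, a l ≤ ∑ i ∈ J, ∑ l ∈ marked P F (A i), a l :=
            sum_marked_biUnion_le hF.nonneg _ Subset.rfl
        _ ≤ ∑ i ∈ J, δ / (2 * ((N : ℝ) + 1)) := by
            refine sum_le_sum fun i hi => hF.small _ ?_
            refine looseSchreier_mono ?_ (schreier_subset_looseSchreier (hA i hi))
            exact G.k_mono _ _ (by have := hs i hi; omega) (by have := hsj i hi; omega)
        _ = (J.card : ℝ) * (δ / (2 * ((N : ℝ) + 1))) := by simp
        _ ≤ ((N : ℝ) + 1) * (δ / (2 * ((N : ℝ) + 1))) := by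
            have : (J.card : ℝ) ≤ N := by exact_mod_cast hJ
            gcongr; linarith
        _ = δ / 2 := by field_simp
    have hx' : 1 / 2 * ∑ i ∈ J, pairing x (f i) ≤ θ + δ / 2 := by
      calc 1 / 2 * ∑ i ∈ J, pairing x (f i)
          = ∑ l ∈ F, a l * (1 / 2 * ∑ i ∈ J, pairing (y l) (f i)) := by
            simp only [hx, pairing_sum_left, pairing_smul, mul_sum]
            rw [sum_comm]
            exact sum_congr rfl fun l _ => sum_congr rfl fun i _ => by ring
        _ ≤ ∑ l ∈ F, a l * (θ + if l ∈ Mk then 1 else 0) :=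
            sum_le_sum fun l hlF => mul_le_mul_of_nonneg_left (hl l hlF) (hF.nonneg l)
        _ = θ + ∑ l ∈ Mk, a l := by
            simp only [mul_add, sum_add_distrib, ← sum_mul, hF.sum_eq, one_mul, mul_ite, mul_one,
              mul_zero]
            rw [← sum_filter]
            congr 2
            ext l
            simp only [mem_filter, and_iff_right_iff_imp]
            exact fun h => (mem_filter.1 h).1
        _ ≤ θ + δ / 2 := by linarith
    simp only [pairing_smul]
    rw [← mul_sum]
    calc 1 / 2 * (ν⁻¹ * ∑ i ∈ J, pairing x (f i)) = ν⁻¹ * (1 / 2 * ∑ i ∈ J, pairing x (f i)) := by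
          ring
      _ ≤ ν⁻¹ * (θ + δ / 2) := by gcongr
      _ ≤ 2 * (θ + δ / 2) := by gcongr
      _ = _ := by ring

end GrowthData

/-! ### Rapidly increasing sequences -/

/-- A rapidly increasing sequence: `z κ` lives on `(Q κ, Q (κ + 1)]`, is not split by few
functionals of weight index `< p κ`, and is annihilated up to `δ` by those of weight index
`≥ p (κ + 1)`. -/
structure IsRIS (m k : ℕ → ℕ) (δ : ℝ) (Q p : ℕ → ℕ) (z : ℕ → (ℕ+ →₀ ℝ)) : Prop where
  Q_mono : StrictMono Q
  Q_pos : ∀ κ, 1 ≤ Q κ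
  p_mono : StrictMono p
  interval : ∀ κ, ∀ x ∈ (z κ).support, Q κ < (x : ℕ) ∧ (x : ℕ) ≤ Q (κ + 1)
  sq_lt : ∀ κ, ∀ x ∈ (z κ).support, Q κ * Q κ < (x : ℕ)
  norm_eq : ∀ κ, mixedNorm m k (z κ) = 1
  unsplit : ∀ (κ d : ℕ) (f : Fin d → (ℕ+ →₀ ℝ)) (J : Finset (Fin d)) (θ : ℝ), J.card ≤ Q κ →
    0 ≤ θ → (∀ i ∈ J, f i ∈ mixedSet m k) →
    (∀ i ∈ J, ∀ i' ∈ J, i ≠ i' → Disjoint (f i).support (f i').support) →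
    (∀ i ∈ J, ∃ s A, 2 ≤ s ∧ s < p κ ∧ A ∈ schreier (k s) ∧ HasWeight m k s A (f i) ∧
      1 / (m s : ℝ) ≤ θ) →
    1 / 2 * ∑ i ∈ J, pairing (z κ) (f i) ≤ 2 * θ + δ
  tiny : ∀ (κ d : ℕ) (f : Fin d → (ℕ+ →₀ ℝ)) (J : Finset (Fin d)),
    (∀ i ∈ J, ∀ i' ∈ J, i ≠ i' → Disjoint (f i).support (f i').support) →
    (∀ i ∈ J, ∃ s A, p (κ + 1) ≤ s ∧ HasWeight m k s A (f i)) →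
    1 / 2 * ∑ i ∈ J, pairing (z κ) (f i) ≤ δ

theorem abs_sum_le_of_disjoint {ι : Type*} (J : Finset ι) (f : ι → (ℕ+ →₀ ℝ)) {c : ℝ}
    (hc : 0 ≤ c) (n : ℕ+) (h : ∀ i ∈ J, |f i n| ≤ c)
    (hdis : ∀ i ∈ J, ∀ i' ∈ J, i ≠ i' → Disjoint (f i).support (f i').support) :
    |∑ i ∈ J, f i n| ≤ c := by
  by_cases h0 : ∀ i ∈ J, f i n = 0
  · rw [sum_eq_zero h0, abs_zero]; exact hc
  · push Not at h0
    obtain ⟨i, hi, hin⟩ := h0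
    rw [Finset.sum_eq_single_of_mem i hi fun j hj hne => ?_]
    · exact h i hi
    · by_contra h1
      exact Finset.disjoint_left.1 (hdis j hj i hi hne) (Finsupp.mem_support_iff.2 h1)
        (Finsupp.mem_support_iff.2 hin)

theorem HasWeight.abs_apply_le {m k : ℕ → ℕ} {s : ℕ} {A : Finset ℕ+} {f : ℕ+ →₀ ℝ}
    (hf : HasWeight m k s A f) (n : ℕ+) : |f n| ≤ 1 / (m s : ℝ) := by
  obtain ⟨d, g, hg, hlt, -, rfl⟩ := hf
  have h1 : |∑ i, g i n| ≤ 1 := by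
    refine abs_sum_le_of_disjoint univ g zero_le_one n
      (fun i _ => abs_apply_le_one (recip_mem m) (hg i) n) fun i _ j _ hij => ?_
    rw [Finset.disjoint_left]
    intro q hi hj
    rcases lt_or_gt_of_ne hij with h | h
    · exact lt_irrefl q (hlt i j h q hi q hj)
    · exact lt_irrefl q (hlt j i h q hj q hi)
  rw [Finsupp.smul_apply, Finsupp.finsetSum_apply, smul_eq_mul, abs_mul,
    abs_of_nonneg (by positivity)]
  exact mul_le_of_le_one_right (by positivity) h1

/-- At each point at most one functional is nonzero, so the bound does not depend on their number.
This yields the field `tiny` of a rapidly increasing sequence. -/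
theorem sum_pairing_le_of_disjoint {ι : Type*} (J : Finset ι) (f : ι → (ℕ+ →₀ ℝ)) {c : ℝ}
    (hc : 0 ≤ c) (h : ∀ i ∈ J, ∀ n, |f i n| ≤ c)
    (hdis : ∀ i ∈ J, ∀ i' ∈ J, i ≠ i' → Disjoint (f i).support (f i').support) (x : ℕ+ →₀ ℝ) :
    ∑ i ∈ J, pairing x (f i) ≤ c * ∑ n ∈ x.support, |x n| := by
  rw [← pairing_sum_right, mul_sum]
  refine sum_le_sum fun n _ => ?_
  calc x n * (∑ i ∈ J, f i) n ≤ |x n * (∑ i ∈ J, f i) n| := le_abs_self _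
    _ = |x n| * |∑ i ∈ J, f i n| := by rw [abs_mul, Finsupp.finsetSum_apply]
    _ ≤ |x n| * c := by
      gcongr
      exact abs_sum_le_of_disjoint J f hc n (fun i hi => h i hi n) hdis
    _ = c * |x n| := mul_comm _ _

theorem GrowthData.exists_isRIS {m k : ℕ → ℕ} (G : GrowthData m k) {U : Submodule ℝ (ℕ+ →₀ ℝ)}
    (hU : TailNontrivial U) {δ : ℝ} (hδ : 0 < δ) :
    ∃ Q p z, IsRIS m k δ Q p z ∧ ∀ κ, z κ ∈ U := by
  obtain ⟨st, z, -, hst⟩ := exists_chain (I := fun s : ℕ × ℕ => 1 ≤ s.1 ∧ 2 ≤ s.2)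
    (R := fun s s' (z : ℕ+ →₀ ℝ) => s.1 < s'.1 ∧ s.2 < s'.2 ∧ z ∈ U ∧ mixedNorm m k z = 1 ∧
      (∀ x ∈ z.support, s.1 < (x : ℕ) ∧ (x : ℕ) ≤ s'.1 ∧ s.1 * s.1 < (x : ℕ)) ∧
      (∀ (d : ℕ) (f : Fin d → (ℕ+ →₀ ℝ)) (J : Finset (Fin d)) (θ : ℝ), J.card ≤ s.1 → 0 ≤ θ →
        (∀ i ∈ J, f i ∈ mixedSet m k) →
        (∀ i ∈ J, ∀ i' ∈ J, i ≠ i' → Disjoint (f i).support (f i').support) →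
        (∀ i ∈ J, ∃ j A, 2 ≤ j ∧ j < s.2 ∧ A ∈ schreier (k j) ∧ HasWeight m k j A (f i) ∧
          1 / (m j : ℝ) ≤ θ) →
        1 / 2 * ∑ i ∈ J, pairing z (f i) ≤ 2 * θ + δ) ∧
      (∑ n ∈ z.support, |z n|) / δ ≤ (s'.2 : ℝ)) (s₀ := (1, 2)) ⟨le_rfl, le_rfl⟩
    (fun s hs => by
      -- The state is `(Q κ, p κ)`. Starting beyond the square of `Q κ` leaves room for `Q κ` half
      -- sums with `Q κ` summands each.
      obtain ⟨z, hzU, hz1, hzL, hz⟩ := G.exists_unsplit_vector hU hs.2 hδ s.1 (max s.1 (s.1 * s.1))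
      -- The next `p` dominates the `ℓ¹`-norm of `z` divided by `δ`. As `m s ≥ s`, functionals of
      -- weight index at least that `p` have coefficients small enough to make their total action on
      -- `z` at most `δ`.
      obtain ⟨r, hr⟩ := exists_nat_ge ((∑ n ∈ z.support, |z n|) / δ)
      refine ⟨(max (s.1 + 1) (z.support.sup fun x => (x : ℕ)), max (s.2 + 1) r), z,
        ⟨by simp only; omega, by simp only; omega⟩, by simp only; omega, by simp only; omega, hzU,
        hz1, fun x hx => ⟨?_, ?_, ?_⟩, hz, ?_⟩
      · exact (le_max_left _ _).trans_lt (hzL x hx)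
      · exact le_trans (le_sup (f := fun p : ℕ+ => (p : ℕ)) hx) (le_max_right _ _)
      · exact (le_max_right _ _).trans_lt (hzL x hx)
      · exact hr.trans (by exact_mod_cast le_max_right _ _))
  have hpm : StrictMono fun κ => (st κ).2 := strictMono_nat_of_lt_succ fun κ => (hst κ).2.2.1
  refine ⟨fun κ => (st κ).1, fun κ => (st κ).2, z,
    ⟨strictMono_nat_of_lt_succ fun κ => (hst κ).2.1, fun κ => (hst κ).1.1, hpm,
      fun κ x hx => ⟨((hst κ).2.2.2.2.2.1 x hx).1, ((hst κ).2.2.2.2.2.1 x hx).2.1⟩,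
      fun κ x hx => ((hst κ).2.2.2.2.2.1 x hx).2.2, fun κ => (hst κ).2.2.2.2.1,
      fun κ => (hst κ).2.2.2.2.2.2.1, ?_⟩, fun κ => (hst κ).2.2.2.1⟩
  intro κ d f J hdis hw
  have hp2 : 2 ≤ (st (κ + 1)).2 := (hst (κ + 1)).1.2
  have hp0 : (0 : ℝ) < (st (κ + 1)).2 := by exact_mod_cast (by omega : 0 < (st (κ + 1)).2)
  have h1 := sum_pairing_le_of_disjoint J f (c := 1 / ((st (κ + 1)).2 : ℝ)) (by positivity)
    (fun i hi n => ?_) hdis (z κ)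
  · have h2 := (hst κ).2.2.2.2.2.2.2
    rw [div_le_iff₀ hδ] at h2
    have h3 : 1 / ((st (κ + 1)).2 : ℝ) * ∑ n ∈ (z κ).support, |z κ n| ≤ δ := by
      rw [one_div, inv_mul_le_iff₀ hp0]; exact h2
    linarith
  · obtain ⟨s, A, hs, hsA⟩ := hw i hi
    refine (hsA.abs_apply_le n).trans ?_
    have : (st (κ + 1)).2 ≤ m s := hs.trans (G.le_m s (by omega))
    exact one_div_le_one_div_of_le hp0 (by exact_mod_cast this)

/-! ### Averages of convex combinations of a rapidly increasing sequence -/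

/-- The endpoint of the interval of the vector `z κ` for which the weight index `s` is critical. -/
noncomputable def criticalPoint (Q p : ℕ → ℕ) (s : ℕ) : ℕ+ :=
  open Classical in
  if h : ∃ κ, p κ ≤ s ∧ s < p (κ + 1) then (Q (h.choose + 1)).toPNat' else 1

theorem support_linearCombination {c : ℕ →₀ ℝ} {z : ℕ → (ℕ+ →₀ ℝ)} {x : ℕ+}
    (hx : x ∈ (Finsupp.linearCombination ℝ z c).support) :
    ∃ κ ∈ c.support, x ∈ (z κ).support := by
  rw [Finsupp.linearCombination_apply, Finsupp.sum] at hx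
  exact support_sum_smul_subset _ _ _ hx

theorem pairing_linearCombination (c : ℕ →₀ ℝ) (z : ℕ → (ℕ+ →₀ ℝ)) (f : ℕ+ →₀ ℝ) :
    pairing (Finsupp.linearCombination ℝ z c) f = ∑ κ ∈ c.support, c κ * pairing (z κ) f := by
  rw [Finsupp.linearCombination_apply, Finsupp.sum, pairing_sum_left]
  simp only [pairing_smul]

theorem support_subset_of_half {d : ℕ} {g : Fin d → (ℕ+ →₀ ℝ)}
    (hdis : ∀ i j, i ≠ j → Disjoint (g i).support (g j).support) (i : Fin d) :
    (g i).support ⊆ ((1 / 2 : ℝ) • ∑ i, g i).support := by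
  intro p hp
  have h1 : ∑ j, g j p = g i p := by
    refine Finset.sum_eq_single _ (fun j _ hj => ?_) (by simp)
    by_contra h3
    exact Finset.disjoint_left.1 (hdis j _ hj) (Finsupp.mem_support_iff.2 h3) hp
  rw [Finsupp.mem_support_iff] at hp ⊢
  simp only [Finsupp.smul_apply, Finsupp.finsetSum_apply, h1, smul_eq_mul]
  positivity

namespace IsRIS
variable {m k : ℕ → ℕ} {δ : ℝ} {Q p : ℕ → ℕ} {z : ℕ → (ℕ+ →₀ ℝ)}

/-- Since `p` is strictly increasing, at most one `κ` satisfies `p κ ≤ s < p (κ + 1)`. Its mark `Q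
(κ + 1)` lies in `(Q (l i), Q (l (i + 1))]` as soon as `l i ≤ κ < l (i + 1)`. -/
theorem not_critical (R : IsRIS m k δ Q p z) {l : ℕ → ℕ} {i s : ℕ}
    (h : ¬(Q (l i) < (criticalPoint Q p s : ℕ) ∧ (criticalPoint Q p s : ℕ) ≤ Q (l (i + 1))))
    {κ : ℕ} (h1 : l i ≤ κ) (h2 : κ < l (i + 1)) : s < p κ ∨ p (κ + 1) ≤ s := by
  by_contra! hc
  have hex : ∃ κ, p κ ≤ s ∧ s < p (κ + 1) := ⟨κ, hc⟩
  have heq : hex.choose = κ := by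
    have h3 := hex.choose_spec
    have h4 : hex.choose < κ + 1 := R.p_mono.lt_iff_lt.1 (h3.1.trans_lt hc.2)
    have h5 : κ < hex.choose + 1 := R.p_mono.lt_iff_lt.1 (hc.1.trans_lt h3.2)
    omega
  have hcp : (criticalPoint Q p s : ℕ) = Q (κ + 1) := by
    have h0 := R.Q_pos (κ + 1)
    rw [criticalPoint, dif_pos hex, heq, Nat.toPNat'_coe, if_pos (by omega)]
  rw [hcp] at h
  exact h ⟨R.Q_mono (by omega), R.Q_mono.monotone (by omega)⟩

/-- With no critical index in the range, for each term `z κ` the functionals divide into those that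
do not split it, contributing at most `2 * θ + δ`, and those that barely see it, contributing at
most `δ`. The convex combination inherits the bound. -/
theorem heavy_le (R : IsRIS m k δ Q p z) {i₀ i₁ : ℕ} {c : ℕ →₀ ℝ}
    (hc : ∀ κ ∈ c.support, i₀ ≤ κ ∧ κ < i₁) (hc0 : ∀ κ, 0 ≤ c κ)
    (hc1 : Finsupp.linearCombination ℝ (fun _ : ℕ => (1 : ℝ)) c = 1)
    {d : ℕ} {f : Fin d → (ℕ+ →₀ ℝ)} {J : Finset (Fin d)} {θ : ℝ} (hJ : J.card ≤ Q i₀)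
    (hθ : 0 ≤ θ) (hK : ∀ i ∈ J, f i ∈ mixedSet m k)
    (hdis : ∀ i ∈ J, ∀ i' ∈ J, i ≠ i' → Disjoint (f i).support (f i').support)
    {s : Fin d → ℕ} {A : Fin d → Finset ℕ+}
    (hw : ∀ i ∈ J, 2 ≤ s i ∧ A i ∈ schreier (k (s i)) ∧ HasWeight m k (s i) (A i) (f i) ∧
      1 / (m (s i) : ℝ) ≤ θ)
    (hcrit : ∀ i ∈ J, ∀ κ, i₀ ≤ κ → κ < i₁ → s i < p κ ∨ p (κ + 1) ≤ s i) :
    1 / 2 * ∑ i ∈ J, pairing (Finsupp.linearCombination ℝ z c) (f i) ≤ 2 * θ + 2 * δ := by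
  classical
  have hκ : ∀ κ ∈ c.support, 1 / 2 * ∑ i ∈ J, pairing (z κ) (f i) ≤ 2 * θ + 2 * δ := by
    intro κ hκ
    obtain ⟨h1, h2⟩ := hc κ hκ
    set J₁ := J.filter fun i => s i < p κ with hJ1
    set J₂ := J.filter fun i => ¬s i < p κ with hJ2
    have hs1 : ∀ i ∈ J₁, i ∈ J := fun i hi => (mem_filter.1 hi).1
    have hs2 : ∀ i ∈ J₂, i ∈ J := fun i hi => (mem_filter.1 hi).1
    have b1 := R.unsplit κ d f J₁ θ
      ((card_le_card (filter_subset _ _)).trans (hJ.trans (R.Q_mono.monotone h1))) hθ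
      (fun i hi => hK i (hs1 i hi)) (fun i hi i' hi' => hdis i (hs1 i hi) i' (hs1 i' hi'))
      (fun i hi => ⟨s i, A i, (hw i (hs1 i hi)).1, (mem_filter.1 hi).2, (hw i (hs1 i hi)).2⟩)
    have b2 := R.tiny κ d f J₂ (fun i hi i' hi' => hdis i (hs2 i hi) i' (hs2 i' hi'))
      (fun i hi => ⟨s i, A i, (hcrit i (hs2 i hi) κ h1 h2).resolve_left (mem_filter.1 hi).2,
        (hw i (hs2 i hi)).2.2.1⟩)
    rw [← sum_filter_add_sum_filter_not J (fun i => s i < p κ)]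
    linarith
  have hsum : ∑ κ ∈ c.support, c κ = 1 := by
    rw [← hc1, Finsupp.linearCombination_apply, Finsupp.sum]
    simp
  calc 1 / 2 * ∑ i ∈ J, pairing (Finsupp.linearCombination ℝ z c) (f i)
      = ∑ κ ∈ c.support, c κ * (1 / 2 * ∑ i ∈ J, pairing (z κ) (f i)) := by
        simp only [pairing_linearCombination, mul_sum]
        rw [sum_comm]
        exact sum_congr rfl fun l _ => sum_congr rfl fun i _ => by ring
    _ ≤ ∑ κ ∈ c.support, c κ * (2 * θ + 2 * δ) :=
        sum_le_sum fun κ h => mul_le_mul_of_nonneg_left (hκ κ h) (hc0 κ)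
    _ = 2 * θ + 2 * δ := by rw [← sum_mul, hsum, one_mul]

end IsRIS

/-! ### Marked intervals and the gain on unmarked ones -/

namespace IsRIS
variable {m k : ℕ → ℕ} {δ : ℝ} {Q p : ℕ → ℕ} {z : ℕ → (ℕ+ →₀ ℝ)}

/-- A convex combination of the terms of index in `[i₀, i₁)`. -/
structure IsConvex (i₀ i₁ : ℕ) (c : ℕ →₀ ℝ) : Prop where
  mem : ∀ κ ∈ c.support, i₀ ≤ κ ∧ κ < i₁
  nonneg : ∀ κ, 0 ≤ c κ
  total : Finsupp.linearCombination ℝ (fun _ : ℕ => (1 : ℝ)) c = 1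

theorem interval_combination (R : IsRIS m k δ Q p z) {i₀ i₁ : ℕ} {c : ℕ →₀ ℝ}
    (hc : IsConvex i₀ i₁ c) :
    ∀ x ∈ (Finsupp.linearCombination ℝ z c).support,
      (Q i₀ < (x : ℕ) ∧ (x : ℕ) ≤ Q i₁) ∧ Q i₀ * Q i₀ < (x : ℕ) := by
  intro x hx
  obtain ⟨κ, hκ, hx⟩ := support_linearCombination hx
  have h1 := R.interval κ x hx
  have h2 := R.sq_lt κ x hx
  obtain ⟨h3, h4⟩ := hc.mem κ hκ
  have h5 : Q i₀ ≤ Q κ := R.Q_mono.monotone h3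
  have h6 : Q (κ + 1) ≤ Q i₁ := R.Q_mono.monotone h4
  have h7 : Q i₀ * Q i₀ ≤ Q κ * Q κ := Nat.mul_le_mul h5 h5
  omega

/-- The contribution of the half sums among the functionals that start before `w`. -/
theorem sum_half_le (G : GrowthData m k) {d N : ℕ} {g : Fin d → (ℕ+ →₀ ℝ)} {J : Finset (Fin d)}
    (hJ : J.card ≤ N) (hdis : ∀ i ∈ J, ∀ i' ∈ J, i ≠ i' → Disjoint (g i).support (g i').support)
    (hhalf : ∀ i ∈ J, IsHalfSum m k (g i)) (hstart : ∀ i ∈ J, (minSupp (g i) : ℕ) ≤ N)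
    {w : ℕ+ →₀ ℝ} (hw : ∀ x ∈ w.support, N * N < (x : ℕ)) :
    ∑ i ∈ J, pairing w (g i) ≤ mixedNorm m k w := by
  classical
  have hex : ∀ i, ∃ (e : ℕ) (h : Fin e → (ℕ+ →₀ ℝ)), i ∈ J → (∀ b, h b ∈ mixedSet m k) ∧
      (∀ b b', b ≠ b' → Disjoint (h b).support (h b').support) ∧
      (∀ b, ∀ a ∈ (h b).support, e ≤ (a : ℕ)) ∧ g i = (1 / 2 : ℝ) • ∑ b, h b := by
    intro i
    by_cases hi : i ∈ J
    · obtain ⟨e, h, hh⟩ := hhalf i hi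
      exact ⟨e, h, fun _ => hh⟩
    · exact ⟨0, fun _ => 0, fun h => absurd h hi⟩
  choose e h hh using hex
  have hsub : ∀ i ∈ J, ∀ b, (h i b).support ⊆ (g i).support := by
    intro i hi b
    rw [(hh i hi).2.2.2]
    exact support_subset_of_half (hh i hi).2.1 b
  have he : ∀ i ∈ J, e i ≤ N := by
    intro i hi
    rcases Nat.eq_zero_or_pos (e i) with h0 | h0
    · omega
    · have hb := minSupp_mem (G.ne_zero ((hh i hi).1 ⟨0, h0⟩))
      have hg0 : g i ≠ 0 := by
        rw [← Finsupp.support_nonempty_iff]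
        exact ⟨_, hsub i hi _ hb⟩
      have h1 := minSupp_mem hg0
      rw [(hh i hi).2.2.2] at h1
      obtain ⟨b, -, hb'⟩ := mem_biUnion.1 (Finsupp.support_finsetSum (Finsupp.support_smul h1))
      have h2 := (hh i hi).2.2.1 b _ hb'
      rw [← (hh i hi).2.2.2] at h2
      exact h2.trans (hstart i hi)
  set I : Finset (Σ i : Fin d, Fin (e i)) := J.sigma fun _ => univ with hI
  have hmem : ∀ x ∈ I, x.1 ∈ J := fun x hx => (mem_sigma.1 hx).1
  have hcard : I.card ≤ N * N + 1 := by
    rw [hI, card_sigma]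
    calc ∑ i ∈ J, (univ : Finset (Fin (e i))).card ≤ ∑ _i ∈ J, N :=
          sum_le_sum fun i hi => by simpa using he i hi
      _ = J.card * N := by simp
      _ ≤ N * N + 1 := (Nat.mul_le_mul_right _ hJ).trans (Nat.le_succ _)
  -- All summands of all the half sums form one disjoint family of at most `N * N` functionals, and
  -- `w` lives beyond `N * N`. The inner factor `1/2` is the one used up here; the outer factor is
  -- still available to the caller.
  have h1 := G.half_sum_pairing_le I (fun x => h x.1 x.2) (fun _ => 1) (θ := 1)
    (fun _ _ => ⟨zero_le_one, le_rfl⟩) zero_le_one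
    (fun x hx => Or.inl ((hh x.1 (hmem x hx)).1 x.2)) (fun x hx y hy hxy => ?_) hw hcard
  · simp only [one_mul] at h1
    refine le_trans (le_of_eq ?_) h1
    rw [hI, sum_sigma, mul_sum]
    refine sum_congr rfl fun i hi => ?_
    conv_lhs => rw [(hh i hi).2.2.2, pairing_smul_right, pairing_sum_right]
  · obtain ⟨i, b⟩ := x
    obtain ⟨i', b'⟩ := y
    by_cases hii : i = i'
    · subst hii
      exact (hh i (hmem _ hx)).2.1 b b' fun h => hxy (by rw [h])
    · exact Disjoint.mono (hsub i (hmem _ hx) b) (hsub i' (hmem _ hy) b')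
        (hdis i (hmem _ hx) i' (hmem _ hy) hii)

/-- Half sums act on the unmarked convex combinations with norm at most `4 / 5` of the
original bound. -/
theorem half_sum_unmarked_le (G : GrowthData m k) (R : IsRIS m k δ Q p z) {s₀ : ℕ} (hs₀ : 2 ≤ s₀)
    {τ : ℝ} (hsmall : 2 * (1 / (m s₀ : ℝ)) + 2 * δ ≤ τ / 10) {i₀ i₁ : ℕ} {c : ℕ →₀ ℝ}
    (hc : IsConvex i₀ i₁ c)
    (hτ : mixedNorm m k (Finsupp.linearCombination ℝ z c) ≤ τ)
    {d : ℕ} {g : Fin d → (ℕ+ →₀ ℝ)} (hg : ∀ i, g i ∈ mixedSet m k)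
    (hdis : ∀ i j, i ≠ j → Disjoint (g i).support (g j).support)
    (hd : ∀ i, ∀ a ∈ (g i).support, d ≤ (a : ℕ)) {s : Fin d → ℕ} {A : Fin d → Finset ℕ+}
    (hcase : ∀ i, (∃ q, (g i).support = {q}) ∨ IsHalfSum m k (g i) ∨
      (2 ≤ s i ∧ A i ∈ schreier (k (s i)) ∧ HasWeight m k (s i) (A i) (g i)))
    (h1 : ∀ i, ¬(Q i₀ < (minSupp (g i) : ℕ) ∧ (minSupp (g i) : ℕ) ≤ Q i₁))
    (h2 : ∀ i, 2 ≤ s i → s i < s₀ → ∀ q ∈ A i, d ≤ (q : ℕ) → ¬(Q i₀ < (q : ℕ) ∧ (q : ℕ) ≤ Q i₁))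
    (h3 : d ≤ Q i₀ → ∀ i, ∀ κ, i₀ ≤ κ → κ < i₁ → s i < p κ ∨ p (κ + 1) ≤ s i) :
    pairing (Finsupp.linearCombination ℝ z c) ((1 / 2 : ℝ) • ∑ i, g i) ≤ 4 / 5 * τ := by
  classical
  set w := Finsupp.linearCombination ℝ z c with hw
  have hwI := R.interval_combination hc
  have hτ0 : 0 ≤ τ := (mixedNorm_nonneg w).trans hτ
  set J : Finset (Fin d) := univ.filter fun i => ¬Disjoint w.support (g i).support with hJ
  have hstart : ∀ i ∈ J, (minSupp (g i) : ℕ) ≤ Q i₀ := by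
    intro i hi
    obtain ⟨x, hxw, hxg⟩ := Finset.not_disjoint_iff.1 (mem_filter.1 hi).2
    have h4 : (minSupp (g i) : ℕ) ≤ x := by exact_mod_cast minSupp_le hxg
    have h5 := (hwI x hxw).1
    have h6 := h1 i
    omega
  rw [pairing_smul_right, pairing_sum_right]
  have hsumJ : ∑ i, pairing w (g i) = ∑ i ∈ J, pairing w (g i) := by
    rw [hJ, sum_filter]
    refine sum_congr rfl fun i _ => ?_
    split_ifs with h
    · exact pairing_eq_zero_of_disjoint h
    · rfl
  rw [hsumJ]
  rcases J.eq_empty_or_nonempty with h0 | ⟨j, hj⟩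
  · rw [h0, sum_empty, mul_zero]; positivity
  -- Some `g j` starts at or before `Q i₀`, and `d` is at most every support point.
  have hdQ : d ≤ Q i₀ := (hd j _ (minSupp_mem (G.ne_zero (hg j)))).trans (hstart j hj)
  have hcardJ : ∀ J' : Finset (Fin d), J'.card ≤ Q i₀ := fun J' =>
    ((card_le_univ J').trans (by simp)).trans hdQ
  -- With the outer factor `1/2`, half sums give `τ / 2`, weight indices below `s₀` give `τ / 5` and
  -- the remaining ones `τ / 10`; together `4/5 * τ`.
  set T := J.filter fun i => IsHalfSum m k (g i) with hT
  set W := J.filter fun i => ¬IsHalfSum m k (g i) with hW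
  set Lt := W.filter fun i => s i < s₀ with hLt
  set Hv := W.filter fun i => ¬s i < s₀ with hHv
  have hWJ : ∀ i ∈ W, i ∈ J := fun i hi => (mem_filter.1 hi).1
  have hLtW : ∀ i ∈ Lt, i ∈ W := fun i hi => (mem_filter.1 hi).1
  have hHvW : ∀ i ∈ Hv, i ∈ W := fun i hi => (mem_filter.1 hi).1
  have hWw : ∀ i ∈ W, 2 ≤ s i ∧ A i ∈ schreier (k (s i)) ∧ HasWeight m k (s i) (A i) (g i) := by
    intro i hi
    rcases hcase i with ⟨q, hq⟩ | h | h
    -- A singleton support is its own starting point: it would lie at or before `Q i₀`, where `w`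
    -- vanishes.
    · exfalso
      obtain ⟨x, hxw, hxg⟩ := Finset.not_disjoint_iff.1 (mem_filter.1 (hWJ i hi)).2
      have h4 := minSupp_mem (G.ne_zero (hg i))
      rw [hq, mem_singleton] at hxg h4
      have h5 := hstart i (hWJ i hi)
      have h6 := (hwI x hxw).1.1
      rw [h4, ← hxg] at h5
      omega
    · exact absurd h (mem_filter.1 hi).2
    · exact h
  have bT : ∑ i ∈ T, pairing w (g i) ≤ τ :=
    (sum_half_le G (hcardJ T) (fun i _ j _ => hdis i j) (fun i hi => (mem_filter.1 hi).2)
      (fun i hi => hstart i (mem_filter.1 hi).1) fun x hx => (hwI x hx).2).trans hτ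
  have bLt : 1 / 2 * ∑ i ∈ Lt, pairing w (g i) ≤ τ / 5 := by
    have hun : ∀ i ∈ Lt, ∃ f, (f ∈ mixedSet m k ∨ f = 0) ∧ f.support ⊆ (g i).support ∧
        pairing w (g i) = 1 / (m (s i) : ℝ) * pairing w f := by
      intro i hi
      obtain ⟨hs2, -, hwt⟩ := hWw i (hLtW i hi)
      refine G.exists_unsplit (by omega) hwt (fun x hx => (hwI x hx).1) fun q hq hqI => ?_
      exact h2 i hs2 (mem_filter.1 hi).2 q hq (by omega) hqI
    choose! f hf hfs hfp using hun
    have b := G.half_sum_pairing_le Lt f (fun i => 1 / (m (s i) : ℝ)) (θ := 1 / 5)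
      (fun i hi => ⟨by positivity, ?_⟩) (by norm_num) hf
      (fun i hi i' hi' hne => Disjoint.mono (hfs i hi) (hfs i' hi') (hdis i i' hne))
      (fun x hx => (hwI x hx).1.1) ((hcardJ Lt).trans (Nat.le_succ _))
    · rw [← sum_congr rfl hfp] at b
      linarith
    · have : (5 : ℝ) ≤ m (s i) := by exact_mod_cast G.five_le _ (hWw i (hLtW i hi)).1
      exact one_div_le_one_div_of_le (by norm_num) this
  have bHv : 1 / 2 * ∑ i ∈ Hv, pairing w (g i) ≤ 2 * (1 / (m s₀ : ℝ)) + 2 * δ := by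
    refine R.heavy_le hc.mem hc.nonneg hc.total (hcardJ Hv) (by positivity) (fun i _ => hg i)
      (fun i _ j _ => hdis i j) (s := s) (A := A) (fun i hi => ?_)
      (fun i _ => h3 hdQ i)
    have hi' := hWw i (hHvW i hi)
    refine ⟨hi'.1, hi'.2.1, hi'.2.2, ?_⟩
    have h4 : m s₀ ≤ m (s i) := G.m_mono _ _ (by omega) (not_lt.1 (mem_filter.1 hi).2)
    have h5 := G.one_le_m s₀ (by omega)
    exact one_div_le_one_div_of_le (by exact_mod_cast h5) (by exact_mod_cast h4)
  rw [← sum_filter_add_sum_filter_not J (fun i => IsHalfSum m k (g i)), ← hT, ← hW,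
    ← sum_filter_add_sum_filter_not W (fun i => s i < s₀), ← hLt, ← hHv]
  linarith

/-- For each functional there are few marked indices, and it acts on the unmarked convex
combinations with norm at most `4 / 5` of the original bound. -/
theorem exists_marks (G : GrowthData m k) (R : IsRIS m k δ Q p z) {s₀ : ℕ} (hs₀ : 2 ≤ s₀)
    {τ : ℝ} (hsmall : 2 * (1 / (m s₀ : ℝ)) + 2 * δ ≤ τ / 10) {l : ℕ → ℕ} {n : ℕ}
    (hn : k s₀ + 1 ≤ n) {c : ℕ → ℕ →₀ ℝ} (hc : ∀ i, IsConvex (l i) (l (i + 1)) (c i))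
    (hτ : ∀ i, mixedNorm m k (Finsupp.linearCombination ℝ z (c i)) ≤ τ)
    {f : ℕ+ →₀ ℝ} (hf : f ∈ mixedSet m k) :
    ∃ B : Fin 3 → Finset ℕ+, (∀ b, B b ∈ looseSchreier n) ∧ ∀ i,
      (∀ b, ∀ q ∈ B b, ¬(Q (l i) < (q : ℕ) ∧ (q : ℕ) ≤ Q (l (i + 1)))) →
      pairing (Finsupp.linearCombination ℝ z (c i)) f ≤ 4 / 5 * τ := by
  classical
  have hτ0 : 0 ≤ τ := (mixedNorm_nonneg _).trans (hτ 0)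
  have hw := fun i => R.interval_combination (hc i)
  have hcrit : ∀ s i, (∀ b : Fin 3, ∀ q ∈ ({criticalPoint Q p s} : Finset ℕ+),
      ¬(Q (l i) < (q : ℕ) ∧ (q : ℕ) ≤ Q (l (i + 1)))) →
      ∀ κ, l i ≤ κ → κ < l (i + 1) → s < p κ ∨ p (κ + 1) ≤ s := by
    intro s i h κ h1 h2
    exact R.not_critical (h 0 _ (mem_singleton_self _)) h1 h2
  rcases G.cases_mem hf with ⟨q, hq⟩ | ⟨d, g, hg, hdis, hd, rfl⟩ | ⟨s, hs, A, hA, hwt⟩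
  · refine ⟨fun _ => {q}, fun _ => singleton_mem_looseSchreier n q, fun i hi => ?_⟩
    rw [pairing_eq_zero_of_disjoint]
    · positivity
    · rw [hq, Finset.disjoint_singleton_right]
      exact fun h => hi 0 q (mem_singleton_self _) (hw i q h).1
  · have hex : ∀ i, ∃ (s : ℕ) (A : Finset ℕ+), (2 ≤ s → A ∈ schreier (k s)) ∧
        ((∃ q, (g i).support = {q}) ∨ IsHalfSum m k (g i) ∨
          (2 ≤ s ∧ A ∈ schreier (k s) ∧ HasWeight m k s A (g i))) := by
      intro i
      rcases G.cases_mem (hg i) with h | h | ⟨s, hs, A, hA, hwt⟩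
      · exact ⟨0, ∅, by simp, Or.inl h⟩
      · exact ⟨0, ∅, by simp, Or.inr (Or.inl h)⟩
      · exact ⟨s, A, fun _ => hA, Or.inr (Or.inr ⟨hs, hA, hwt⟩)⟩
    choose s A hsA hcase using hex
    -- Three kinds of marks: where the `g i` start, where pieces of the light ones start, and the
    -- critical points of their weight indices. Sets of starting points outside the loose family,
    -- possible only for heavy weights, are discarded.
    let C : Fin 3 → Fin d → Finset ℕ+ := fun b i =>
      if b = 0 then {minSupp (g i)}
      else if b = 1 then (if A i ∈ looseSchreier (k s₀) then A i else ∅)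
      else {criticalPoint Q p (s i)}
    have hC : ∀ b i, C b i ∈ looseSchreier (k s₀) := by
      intro b i
      simp only [C]
      split_ifs with h1 h2 h3
      · exact singleton_mem_looseSchreier _ _
      · exact h3
      · exact empty_mem_looseSchreier _
      · exact singleton_mem_looseSchreier _ _
    -- A union of `d` sets gains one level only beyond `d`. Discarding the marks before `d` is
    -- harmless, since intervals that matter start at or after `d`. The `g i` are merely disjoint,
    -- so these unions need not be successive, and the loose families are used.
    refine ⟨fun b => (univ.biUnion (C b)).filter fun a : ℕ+ => d ≤ (a : ℕ), fun b =>
      looseSchreier_mono hn (biUnion_filter_mem_looseSchreier (hC b)), fun i hi => ?_⟩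
    have hi' : ∀ b j, ∀ q ∈ C b j, d ≤ (q : ℕ) →
        ¬(Q (l i) < (q : ℕ) ∧ (q : ℕ) ≤ Q (l (i + 1))) := fun b j q hq hdq =>
      hi b q (mem_filter.2 ⟨mem_biUnion.2 ⟨j, mem_univ j, hq⟩, hdq⟩)
    refine half_sum_unmarked_le G R hs₀ hsmall (hc i) (hτ i) hg hdis hd hcase ?_ ?_ ?_
    · intro j
      exact hi' 0 j _ (by simp [C]) (hd j _ (minSupp_mem (G.ne_zero (hg j))))
    · intro j hs2 hss q hq hdq
      have hAj : A j ∈ looseSchreier (k s₀) :=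
        looseSchreier_mono (G.k_mono _ _ (by omega) hss.le)
          (schreier_subset_looseSchreier (hsA j hs2))
      exact hi' 1 j q (by simp [C, hAj, hq]) hdq
    · intro hdQ j κ h1 h2
      refine R.not_critical (fun h => ?_) h1 h2
      exact hi' 2 j _ (by simp [C]) (by omega) h
  · by_cases hss : s < s₀
    · refine ⟨fun _ => A, fun _ => looseSchreier_mono ?_ (schreier_subset_looseSchreier hA),
        fun i hi => ?_⟩
      · have := G.k_mono s s₀ (by omega) hss.le
        omega
      · obtain ⟨g, hg, -, hp⟩ := G.exists_unsplit (by omega) hwt (fun x hx => (hw i x hx).1) (hi 0)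
        rw [hp]
        have h5 : (5 : ℝ) ≤ m s := by exact_mod_cast G.five_le s hs
        calc 1 / (m s : ℝ) * pairing _ g ≤ 1 / (m s : ℝ) * τ := by
              gcongr
              exact (pairing_le_mixedNorm hg).trans (hτ i)
          _ ≤ 1 / 5 * τ := by gcongr
          _ ≤ 4 / 5 * τ := by linarith
    · refine ⟨fun _ => {criticalPoint Q p s}, fun _ => singleton_mem_looseSchreier n _,
        fun i hi => ?_⟩
      have h4 : m s₀ ≤ m s := G.m_mono _ _ (by omega) (not_lt.1 hss)
      have h5 := G.one_le_m s₀ (by omega)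
      have h6 := R.heavy_le (hc i).mem (hc i).nonneg (hc i).total (d := 1) (f := fun _ => f)
        (J := univ) (θ := 1 / (m s₀ : ℝ)) (by simpa using R.Q_pos _) (by positivity)
        (fun _ _ => hf) (fun a _ b _ h => absurd (Subsingleton.elim a b) h)
        (s := fun _ => s) (A := fun _ => A) (fun _ _ => ⟨hs, hA, hwt,
          one_div_le_one_div_of_le (by exact_mod_cast h5) (by exact_mod_cast h4)⟩)
        (fun _ _ => hcrit s i hi)
      simp only [univ_unique, sum_singleton] at h6
      linarith

end IsRIS

/-! ### Averages of convex combinations, iterated -/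

namespace IsRIS
variable {m k : ℕ → ℕ} {δ : ℝ} {Q p : ℕ → ℕ} {z : ℕ → (ℕ+ →₀ ℝ)}

/-- For each functional the three sets of marks carry mass at most `3 / 30`, and there the trivial
bound `τ` is used. The unmarked terms contribute at most `4/5 * τ`, hence the factor `9/10`. -/
theorem mixedNorm_average_le (G : GrowthData m k) (R : IsRIS m k δ Q p z) {s₀ : ℕ} (hs₀ : 2 ≤ s₀)
    {τ : ℝ} (hsmall : 2 * (1 / (m s₀ : ℝ)) + 2 * δ ≤ τ / 10) {l : ℕ → ℕ} {n : ℕ}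
    (hn : k s₀ + 1 ≤ n) {c : ℕ → ℕ →₀ ℝ} (hc : ∀ i, IsConvex (l i) (l (i + 1)) (c i))
    (hτ : ∀ i, mixedNorm m k (Finsupp.linearCombination ℝ z (c i)) ≤ τ)
    {L : ℕ} {F : Finset ℕ} {a : ℕ → ℝ} (hF : IsAverage m k n (fun i => Q (l i)) (1 / 30) L F a) :
    mixedNorm m k (∑ i ∈ F, a i • Finsupp.linearCombination ℝ z (c i)) ≤ 9 / 10 * τ := by
  classical
  have hτ0 : 0 ≤ τ := (mixedNorm_nonneg _).trans (hτ 0)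
  refine mixedNorm_le fun f hf => ?_
  obtain ⟨B, hB, hBi⟩ := R.exists_marks G hs₀ hsmall hn hc hτ hf
  set Mk := marked (fun i => Q (l i)) F (univ.biUnion B) with hMk
  have hsum : ∑ i ∈ Mk, a i ≤ 1 / 10 := by
    refine (sum_marked_biUnion_le hF.nonneg univ Subset.rfl).trans ?_
    refine (sum_le_sum fun b _ => hF.small _ (hB b)).trans ?_
    norm_num
  have hi : ∀ i ∈ F, pairing (Finsupp.linearCombination ℝ z (c i)) f ≤
      4 / 5 * τ + if i ∈ Mk then τ else 0 := by
    intro i hiF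
    split_ifs with h
    · have := (pairing_le_mixedNorm (Or.inl hf)).trans (hτ i)
      linarith
    · rw [add_zero]
      refine hBi i fun b q hq hqI => h (mem_filter.2 ⟨hiF, q, mem_biUnion.2 ⟨b, mem_univ b, hq⟩, hqI⟩)
  have hMF : F.filter (fun i => i ∈ Mk) = Mk := by
    ext i
    simp only [mem_filter, and_iff_right_iff_imp]
    exact fun h => (mem_filter.1 h).1
  rw [pairing_sum_left]
  calc ∑ i ∈ F, pairing (a i • Finsupp.linearCombination ℝ z (c i)) f
      = ∑ i ∈ F, a i * pairing (Finsupp.linearCombination ℝ z (c i)) f := by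
        simp only [pairing_smul]
    _ ≤ ∑ i ∈ F, a i * (4 / 5 * τ + if i ∈ Mk then τ else 0) :=
        sum_le_sum fun i h => mul_le_mul_of_nonneg_left (hi i h) (hF.nonneg i)
    _ = 4 / 5 * τ + (∑ i ∈ Mk, a i) * τ := by
        simp only [mul_add, sum_add_distrib, ← sum_mul, hF.sum_eq, one_mul, mul_ite, mul_zero]
        rw [← sum_filter, hMF, sum_mul]
    _ ≤ 4 / 5 * τ + 1 / 10 * τ := by gcongr
    _ = 9 / 10 * τ := by ring

/-- Each round averages a sequence of outputs of the previous round. The norm bound drops by `9/10`,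
whereas the pairing with the sum of the attached functionals is a convex combination of values at
least `1/2`. Admissibility grows by `k s₀ + 2` levels: `k s₀ + 1` for smallness on marks and one for
the average itself. -/
theorem exists_iterated_average (G : GrowthData m k) (R : IsRIS m k δ Q p z) {s₀ : ℕ}
    (hs₀ : 2 ≤ s₀) (t : ℕ)
    (hsmall : 2 * (1 / (m s₀ : ℝ)) + 2 * δ ≤ (9 / 10) ^ t / 10) (L : ℕ) :
    ∃ (L' : ℕ) (c : ℕ →₀ ℝ) (h : ℕ+ →₀ ℝ), L < L' ∧ IsConvex L L' c ∧
      mixedNorm m k (Finsupp.linearCombination ℝ z c) ≤ (9 / 10) ^ t ∧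
      h ∈ admissibleSums m k (t * (k s₀ + 2)) ∧
      (∀ x ∈ h.support, Q L < (x : ℕ) ∧ (x : ℕ) ≤ Q L') ∧
      1 / 2 ≤ pairing (Finsupp.linearCombination ℝ z c) h := by
  classical
  induction t generalizing L with
  | zero =>
    obtain ⟨f, hf, hfz⟩ := exists_pairing_gt (m := m) (k := k) (x := z L) (c := 1 / 2)
      (by rw [R.norm_eq]; norm_num)
    let q : ℕ+ → Prop := fun x => Q L < (x : ℕ) ∧ (x : ℕ) ≤ Q (L + 1)
    have hpair : pairing (z L) (f.filter q) = pairing (z L) f :=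
      pairing_congr_right fun x hx => Finsupp.filter_apply_pos q _ (R.interval L x hx)
    have hlc : Finsupp.linearCombination ℝ z (Finsupp.single L 1) = z L := by simp
    refine ⟨L + 1, Finsupp.single L 1, f.filter q, by omega, ⟨?_, ?_, by simp⟩, ?_, ?_, ?_, ?_⟩
    · intro κ hκ
      have := Finsupp.support_single_subset hκ
      rw [mem_singleton] at this
      omega
    · intro κ
      rw [Finsupp.single_apply]
      split_ifs <;> norm_num
    · rw [hlc, R.norm_eq, pow_zero]
    · rw [zero_mul]
      rcases G.filter_mem hf q with h | h
      · exact h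
      · rw [h, pairing_zero_right] at hpair
        linarith
    · intro x hx
      simp only [Finsupp.support_filter, mem_filter] at hx
      exact hx.2
    · rw [hlc, hpair]; exact hfz.le
  | succ t ih =>
    have hsmall' : 2 * (1 / (m s₀ : ℝ)) + 2 * δ ≤ (9 / 10) ^ t / 10 := by
      have : (9 / 10 : ℝ) ^ (t + 1) ≤ (9 / 10) ^ t := by
        rw [pow_succ]; nlinarith [pow_pos (show (0 : ℝ) < 9 / 10 by norm_num) t]
      linarith
    obtain ⟨l, ch, hl0, hst⟩ := exists_chain (I := fun _ : ℕ => True) (s₀ := L)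
      (R := fun L L' (ch : (ℕ →₀ ℝ) × (ℕ+ →₀ ℝ)) => L < L' ∧ IsConvex L L' ch.1 ∧
        mixedNorm m k (Finsupp.linearCombination ℝ z ch.1) ≤ (9 / 10) ^ t ∧
        ch.2 ∈ admissibleSums m k (t * (k s₀ + 2)) ∧
        (∀ x ∈ ch.2.support, Q L < (x : ℕ) ∧ (x : ℕ) ≤ Q L') ∧
        1 / 2 ≤ pairing (Finsupp.linearCombination ℝ z ch.1) ch.2) trivial
      (fun L _ => by
        obtain ⟨L', c, h, hch⟩ := ih hsmall' L
        exact ⟨L', (c, h), trivial, hch⟩)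
    replace hst := fun i => (hst i).2
    have hlm : StrictMono l := strictMono_nat_of_lt_succ fun i => (hst i).1
    have hP : StrictMono fun i => Q (l i) := R.Q_mono.comp hlm
    obtain ⟨F, a, hF⟩ := exists_average m k (k s₀ + 1) hP (ε := 1 / 30) (by norm_num) 0
    set c := ∑ i ∈ F, a i • (ch i).1 with hc
    have hlc : Finsupp.linearCombination ℝ z c =
        ∑ i ∈ F, a i • Finsupp.linearCombination ℝ z (ch i).1 := by
      simp only [hc, map_sum, map_smul]
    set N := F.sup id + 1 with hN
    have hFN : ∀ i ∈ F, i < N := fun i hi => Nat.lt_succ_of_le (le_sup (f := id) hi)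
    have hlN : ∀ i ∈ F, L ≤ l i ∧ l (i + 1) ≤ l N := fun i hi =>
      ⟨hl0.symm.le.trans (hlm.monotone (Nat.zero_le i)), hlm.monotone (hFN i hi)⟩
    refine ⟨l N, c, ∑ i ∈ F, (ch i).2, ?_, ⟨?_, ?_, ?_⟩, ?_, ?_, ?_, ?_⟩
    · rw [← hl0]; exact hlm (by omega)
    · intro κ hκ
      obtain ⟨i, hi, hκ'⟩ := mem_biUnion.1 (Finsupp.support_finsetSum hκ)
      have h1 := (hst i).2.1.mem κ (Finsupp.support_smul hκ')
      have h2 := hlN i hi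
      omega
    · intro κ
      rw [hc, Finsupp.finsetSum_apply]
      exact sum_nonneg fun i _ => mul_nonneg (hF.nonneg i) ((hst i).2.1.nonneg κ)
    · simp only [hc, map_sum, map_smul, (hst _).2.1.total, smul_eq_mul, mul_one, hF.sum_eq]
    · rw [hlc, pow_succ']
      exact R.mixedNorm_average_le G hs₀ hsmall' le_rfl (fun i => (hst i).2.1)
        (fun i => (hst i).2.2.1) hF
    · have := hF.sum_mem _ _ (fun i _ => (hst i).2.2.2.1) (fun i _ => (hst i).2.2.2.2.1)
      rwa [show (t + 1) * (k s₀ + 2) = t * (k s₀ + 2) + (k s₀ + 1) + 1 by ring]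
    · intro x hx
      obtain ⟨i, hi, hx'⟩ := mem_biUnion.1 (Finsupp.support_finsetSum hx)
      have h1 := (hst i).2.2.2.2.1 x hx'
      have h2 := hlN i hi
      exact ⟨(R.Q_mono.monotone h2.1).trans_lt h1.1, h1.2.trans (R.Q_mono.monotone h2.2)⟩
    · rw [hlc, pairing_block_sums hP F a
        (fun i x hx => (R.interval_combination (hst i).2.1 x hx).1) (fun i => (hst i).2.2.2.2.1)]
      calc (1 / 2 : ℝ) = ∑ i ∈ F, a i * (1 / 2) := by rw [← sum_mul, hF.sum_eq, one_mul]
        _ ≤ _ := sum_le_sum fun i _ => mul_le_mul_of_nonneg_left (hst i).2.2.2.2.2 (hF.nonneg i)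

end IsRIS

/-! ### Distortion on the block subspaces -/

/-- The elements of the norming set whose last operation has weight `1 / m s`. -/
def weightSet (m k : ℕ → ℕ) (s : ℕ) : Set (ℕ+ →₀ ℝ) :=
  {f | f ∈ mixedSet m k ∧ ∃ A ∈ schreier (k s), HasWeight m k s A f}

namespace GrowthData
variable {m k : ℕ → ℕ}

theorem smul_mem_weightSet (G : GrowthData m k) {s : ℕ} (hs : 2 ≤ s) {f : ℕ+ →₀ ℝ}
    (hf : f ∈ mixedSet m k) : (1 / (m s : ℝ)) • f ∈ weightSet m k s :=
  G.smul_mem_of_admissibleSums hs (n := 0) (Nat.zero_le _) hf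

/-- A single functional of weight index `s` is tested on a vector unsplit by indices below `s + 1`:
half the pairing is at most `2 / m s + 1 / m s`. -/
theorem exists_flat_vector (G : GrowthData m k) {U : Submodule ℝ (ℕ+ →₀ ℝ)}
    (hU : TailNontrivial U) {s : ℕ} (hs : 2 ≤ s) :
    ∃ v ∈ U, mixedNorm m k v = 1 ∧ ∀ f ∈ weightSet m k s, pairing v f ≤ 6 / (m s : ℝ) := by
  have hm : (0 : ℝ) < m s := by exact_mod_cast G.one_le_m s (by omega)
  obtain ⟨v, hvU, hv, -, h⟩ := G.exists_unsplit_vector hU (j := s + 1) (by omega)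
    (δ := 1 / (m s : ℝ)) (by positivity) 1 0
  refine ⟨v, hvU, hv, fun f hf => ?_⟩
  obtain ⟨hfK, A, hA, hwt⟩ := hf
  have h1 := h 1 (fun _ => f) univ (1 / (m s : ℝ)) (by simp) (by positivity) (fun _ _ => hfK)
    (fun a _ b _ h => absurd (Subsingleton.elim a b) h)
    (fun _ _ => ⟨s, A, hs, by omega, hA, hwt, le_rfl⟩)
  simp only [univ_unique, sum_singleton] at h1
  calc pairing v f ≤ 2 * (2 * (1 / (m s : ℝ)) + 1 / (m s : ℝ)) := by linarith
    _ = 6 / (m s : ℝ) := by ring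

theorem exists_peak_vector (G : GrowthData m k) (t : ℕ) :
    ∃ s, 2 ≤ s ∧ ∀ U : Submodule ℝ (ℕ+ →₀ ℝ), TailNontrivial U →
      ∃ w ∈ U, mixedNorm m k w ≤ (9 / 10) ^ t ∧
        ∃ f ∈ weightSet m k s, 1 / (2 * (m s : ℝ)) ≤ pairing w f := by
  have hτ : (0 : ℝ) < (9 / 10) ^ t := by positivity
  -- With `τ = (9/10) ^ t`, `m s₀ ≥ 40 / τ` and `δ = τ / 80`, the error `2 / m s₀ + 2 * δ` is at
  -- most `3 * τ / 40`, below the required `τ / 10`.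
  obtain ⟨r, hr⟩ := exists_nat_ge (40 / (9 / 10 : ℝ) ^ t)
  set s₀ := max 2 r with hs₀
  have hm : 40 / (9 / 10 : ℝ) ^ t ≤ m s₀ :=
    hr.trans (by exact_mod_cast (le_max_right 2 r).trans (G.le_m s₀ (by omega)))
  have hm' : 1 / (m s₀ : ℝ) ≤ (9 / 10) ^ t / 40 := by
    rw [one_div_le (lt_of_lt_of_le (by positivity) hm) (by positivity), one_div_div]
    exact hm
  -- Depends on `t` only and is fixed before `U`; `k s ≥ s` makes the sum of order `t * (k s₀ + 2)`
  -- admissible for weight `1 / m s`.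
  set s := max 2 (t * (k s₀ + 2)) with hs
  refine ⟨s, le_max_left _ _, fun U hU => ?_⟩
  obtain ⟨Q, p, z, R, hz⟩ := G.exists_isRIS hU (δ := (9 / 10) ^ t / 80) (by positivity)
  obtain ⟨L', c, h, -, -, hn, hh, -, hp⟩ := R.exists_iterated_average G (s₀ := s₀)
    (le_max_left _ _) t (by linarith) 0
  refine ⟨_, ?_, hn, (1 / (m s : ℝ)) • h, ?_, ?_⟩
  · rw [Finsupp.linearCombination_apply]
    exact U.sum_mem fun κ _ => U.smul_mem _ (hz κ)
  · exact G.smul_mem_of_admissibleSums (le_max_left _ _)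
      ((le_max_right 2 _).trans (G.le_k s (by omega))) hh
  · rw [pairing_smul_right]
    calc 1 / (2 * (m s : ℝ)) = 1 / (m s : ℝ) * (1 / 2) := by ring
      _ ≤ _ := by gcongr

end GrowthData

/-! ### The completion -/

/-- The embedding of `c₀₀` into the space. -/
noncomputable def toSpace (m k : ℕ → ℕ) : (ℕ+ →₀ ℝ) →ₗ[ℝ] SpaceXM1u m k where
  toFun x := ((show PreTsirelson 1 (fun j => schreier (k j)) (fun j => recip (m j)) from x :) :
    SpaceXM1u m k)
  map_add' x y := UniformSpace.Completion.coe_add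
    (α := PreTsirelson 1 (fun j => schreier (k j)) (fun j => recip (m j))) x y
  map_smul' c x := UniformSpace.Completion.coe_smul
    (X := PreTsirelson 1 (fun j => schreier (k j)) (fun j => recip (m j))) c x

/-- The pairing with `f`, as a linear map. -/
noncomputable def pairingLin (f : ℕ+ →₀ ℝ) : (ℕ+ →₀ ℝ) →ₗ[ℝ] ℝ where
  toFun x := pairing x f
  map_add' x y := pairing_add x y f
  map_smul' c x := pairing_smul c x f

section Space
variable {m k : ℕ → ℕ}

theorem norm_toSpace (x : ℕ+ →₀ ℝ) : ‖toSpace m k x‖ = mixedNorm m k x :=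
  UniformSpace.Completion.norm_coe
    (E := PreTsirelson 1 (fun j => schreier (k j)) (fun j => recip (m j))) x

theorem denseRange_toSpace : DenseRange (toSpace m k) :=
  UniformSpace.Completion.denseRange_coe
    (α := PreTsirelson 1 (fun j => schreier (k j)) (fun j => recip (m j)))

/-- The extension of the pairing with `f` to the space. -/
noncomputable def evalSpace (m k : ℕ → ℕ) (f : ℕ+ →₀ ℝ) : SpaceXM1u m k →L[ℝ] ℝ :=
  (pairingLin f).extendOfNorm (toSpace m k)

theorem pairingLin_le {f : ℕ+ →₀ ℝ} (hf : f ∈ mixedSet m k) (x : ℕ+ →₀ ℝ) :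
    ‖pairingLin f x‖ ≤ 1 * ‖toSpace m k x‖ := by
  rw [norm_toSpace, one_mul]
  exact abs_pairing_le hf

theorem evalSpace_toSpace {f : ℕ+ →₀ ℝ} (hf : f ∈ mixedSet m k) (x : ℕ+ →₀ ℝ) :
    evalSpace m k f (toSpace m k x) = pairing x f :=
  LinearMap.extendOfNorm_eq denseRange_toSpace ⟨1, pairingLin_le hf⟩ x

theorem abs_evalSpace_le {f : ℕ+ →₀ ℝ} (hf : f ∈ mixedSet m k) (x : SpaceXM1u m k) :
    |evalSpace m k f x| ≤ ‖x‖ := by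
  have := LinearMap.norm_extendOfNorm_apply_le (f := pairingLin f) (e := toSpace m k)
    denseRange_toSpace 1 (pairingLin_le hf) x
  rwa [one_mul] at this

/-- The seminorm given by the functionals of weight `1 / m s`. -/
noncomputable def weightSeminorm (m k : ℕ → ℕ) (s : ℕ) : Seminorm ℝ (SpaceXM1u m k) :=
  ⨆ f : weightSet m k s, (normSeminorm ℝ ℝ).comp (evalSpace m k f).toLinearMap

theorem bddAbove_weightSeminorm (s : ℕ) : BddAbove (Set.range fun f : weightSet m k s =>
    (normSeminorm ℝ ℝ).comp (evalSpace m k f).toLinearMap) := by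
  refine ⟨normSeminorm ℝ _, ?_⟩
  rintro _ ⟨f, rfl⟩ x
  exact abs_evalSpace_le f.2.1 x

theorem weightSeminorm_apply (s : ℕ) (x : SpaceXM1u m k) :
    weightSeminorm m k s x = ⨆ f : weightSet m k s, |evalSpace m k f x| :=
  Seminorm.iSup_apply (bddAbove_weightSeminorm s)

theorem le_weightSeminorm {s : ℕ} {f : ℕ+ →₀ ℝ} (hf : f ∈ weightSet m k s) (x : SpaceXM1u m k) :
    |evalSpace m k f x| ≤ weightSeminorm m k s x := by
  rw [weightSeminorm_apply]
  refine le_ciSup (f := fun f : weightSet m k s => |evalSpace m k f x|) ⟨‖x‖, ?_⟩ ⟨f, hf⟩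
  rintro _ ⟨g, rfl⟩
  exact abs_evalSpace_le g.2.1 x

theorem weightSeminorm_le {s : ℕ} {x : SpaceXM1u m k} {c : ℝ} (hc : 0 ≤ c)
    (h : ∀ f ∈ weightSet m k s, |evalSpace m k f x| ≤ c) : weightSeminorm m k s x ≤ c := by
  rw [weightSeminorm_apply]
  exact Real.iSup_le (fun f => h f f.2) hc

theorem weightSeminorm_le_norm (s : ℕ) (x : SpaceXM1u m k) : weightSeminorm m k s x ≤ ‖x‖ :=
  weightSeminorm_le (norm_nonneg x) fun _ hf => abs_evalSpace_le hf.1 x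

theorem continuous_weightSeminorm (s : ℕ) : Continuous (weightSeminorm m k s) :=
  Seminorm.continuous_of_le (q := normSeminorm ℝ _) continuous_norm fun x =>
    weightSeminorm_le_norm s x

/-- Each `f` in the norming set, multiplied by `1 / m s`, has weight `1 / m s`: it is a sum with one
term. The inequality passes from `c₀₀` to the completion by density. -/
theorem norm_le_weightSeminorm (G : GrowthData m k) {s : ℕ} (hs : 2 ≤ s) (x : SpaceXM1u m k) :
    1 / (m s : ℝ) * ‖x‖ ≤ weightSeminorm m k s x := by
  have hm : (0 : ℝ) < m s := by exact_mod_cast G.one_le_m s (by omega)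
  refine denseRange_toSpace.induction_on (p := fun x =>
    1 / (m s : ℝ) * ‖x‖ ≤ weightSeminorm m k s x) x
    (isClosed_le (by fun_prop) (continuous_weightSeminorm s)) fun u => ?_
  rw [norm_toSpace, one_div, inv_mul_le_iff₀ hm]
  refine mixedNorm_le fun f hf => ?_
  have hw := G.smul_mem_weightSet hs hf
  have h1 := (le_abs_self _).trans (le_weightSeminorm hw (toSpace m k u))
  rw [evalSpace_toSpace hw.1, pairing_smul_right, one_div, inv_mul_le_iff₀ hm] at h1
  exact h1

/-! ### Approximation of subspaces by block subspaces -/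

theorem mixedNorm_filter_le (G : GrowthData m k) (x : ℕ+ →₀ ℝ) (q : ℕ+ → Prop)
    [DecidablePred q] : mixedNorm m k (x.filter q) ≤ mixedNorm m k x := by
  refine mixedNorm_le fun f hf => ?_
  have h1 : pairing (x.filter q) f = pairing x (f.filter q) := by
    rw [pairing_eq_sum_of_subset (S := x.support) (Finset.filter_subset _ _), pairing,
      Finsupp.sum]
    refine sum_congr rfl fun n _ => ?_
    by_cases h : q n <;> simp [h]
  rw [h1]
  exact pairing_le_mixedNorm (G.filter_mem hf q)

theorem mixedNorm_le_sum (x : ℕ+ →₀ ℝ) : mixedNorm m k x ≤ ∑ n ∈ x.support, |x n| := by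
  refine mixedNorm_le fun f hf => sum_le_sum fun n _ => ?_
  calc x n * f n ≤ |x n * f n| := le_abs_self _
    _ = |x n| * |f n| := abs_mul _ _
    _ ≤ |x n| := mul_le_of_le_one_right (abs_nonneg _) (abs_apply_le_one (recip_mem m) hf n)

theorem pairing_single (x : ℕ+ →₀ ℝ) (q : ℕ+) : pairing x (Finsupp.single q 1) = x q := by
  classical
  simp only [pairing, Finsupp.sum, Finsupp.single_apply, mul_ite, mul_one, mul_zero]
  rw [Finset.sum_ite_eq]
  split_ifs with h
  · rfl
  · exact (Finsupp.notMem_support_iff.1 h).symm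

/-- The points of `ℕ+` that are at most `n`. -/
def initialSegment (n : ℕ) : Finset ℕ+ := (range n).image Nat.succPNat

theorem mem_initialSegment {n : ℕ} {q : ℕ+} : q ∈ initialSegment n ↔ (q : ℕ) ≤ n := by
  simp only [initialSegment, mem_image, mem_range]
  constructor
  · rintro ⟨a, ha, rfl⟩
    simpa using ha
  · intro h
    refine ⟨q.natPred, ?_, PNat.succPNat_natPred q⟩
    have := PNat.natPred_add_one q
    omega

/-- An infinite-dimensional subspace contains normalized vectors whose first coordinates vanish. -/
theorem exists_vanishing_vector {Y : Submodule ℝ (SpaceXM1u m k)} (hY : ¬FiniteDimensional ℝ Y)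
    (n : ℕ) : ∃ y ∈ Y, ‖y‖ = 1 ∧
      ∀ q : ℕ+, (q : ℕ) ≤ n → evalSpace m k (Finsupp.single q 1) y = 0 := by
  let T : Y →ₗ[ℝ] (initialSegment n → ℝ) :=
    (LinearMap.pi fun q : initialSegment n =>
      (evalSpace m k (Finsupp.single (q : ℕ+) 1)).toLinearMap).comp Y.subtype
  -- The first `n` coordinates give only finitely many linear conditions on `Y`.
  have hT : ¬Function.Injective T := fun h => hY (FiniteDimensional.of_injective T h)
  rw [← LinearMap.ker_eq_bot, Submodule.eq_bot_iff] at hT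
  push Not at hT
  obtain ⟨y, hy, hy0⟩ := hT
  have hy0' : (y : SpaceXM1u m k) ≠ 0 := fun h => hy0 (Subtype.ext h)
  refine ⟨‖(y : SpaceXM1u m k)‖⁻¹ • (y : SpaceXM1u m k), Y.smul_mem _ y.2, ?_, fun q hq => ?_⟩
  · rw [norm_smul, norm_inv, norm_norm, inv_mul_cancel₀ (norm_ne_zero_iff.2 hy0')]
  · have h1 : T y ⟨q, mem_initialSegment.2 hq⟩ = 0 := by rw [LinearMap.mem_ker.1 hy]; rfl
    have h2 : evalSpace m k (Finsupp.single q 1) y = 0 := h1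
    rw [map_smul, h2, smul_zero]

theorem exists_approximate_block {Y : Submodule ℝ (SpaceXM1u m k)}
    (hY : ¬FiniteDimensional ℝ Y) (n : ℕ) {η : ℝ} (hη : 0 < η) :
    ∃ u : ℕ+ →₀ ℝ, mixedNorm m k u = 1 ∧ (∀ q ∈ u.support, n < (q : ℕ)) ∧
      ∃ y ∈ Y, ‖toSpace m k u - y‖ ≤ η := by
  classical
  -- The bound `1/2` keeps the norm of the truncated vector at least `1/2`; `η / 2` absorbs the
  -- factor `2` lost in normalizing it.
  set η' := min (η / 2) (1 / 2) with hη'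
  have hη'0 : 0 < η' := by positivity
  obtain ⟨y, hyY, hy1, hy⟩ := exists_vanishing_vector hY n
  -- One error for the approximation and at most `n` for the deleted coordinates, `η'` in all.
  have hε : 0 < η' / (n + 1) := by positivity
  obtain ⟨v, hv⟩ := (denseRange_toSpace (m := m) (k := k)).exists_dist_lt y hε
  rw [dist_comm, dist_eq_norm] at hv
  set u := v.filter fun q : ℕ+ => n < (q : ℕ) with hu
  have hcoord : ∀ q : ℕ+, (q : ℕ) ≤ n → |v q| ≤ η' / (n + 1) := by
    intro q hq
    have hK : Finsupp.single q 1 ∈ mixedSet m k := single_mem_normingSet _ _ _ q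
    have h1 := abs_evalSpace_le hK (toSpace m k v - y)
    rw [map_sub, evalSpace_toSpace hK, hy q hq, pairing_single, sub_zero] at h1
    exact h1.trans hv.le
  have hvu : mixedNorm m k (v - u) ≤ n * (η' / (n + 1)) := by
    have hsub : (v - u).support ⊆ initialSegment n := by
      intro q hq
      rw [mem_initialSegment]
      by_contra hqn
      rw [Finsupp.mem_support_iff, Finsupp.sub_apply, hu,
        Finsupp.filter_apply_pos (fun q : ℕ+ => n < (q : ℕ)) _ (not_le.1 hqn), sub_self] at hq
      exact hq rfl
    calc mixedNorm m k (v - u) ≤ ∑ q ∈ (v - u).support, |(v - u) q| := mixedNorm_le_sum _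
      _ ≤ ∑ q ∈ (v - u).support, η' / (n + 1) := by
          refine sum_le_sum fun q hq => ?_
          have hqn := mem_initialSegment.1 (hsub hq)
          rw [Finsupp.sub_apply, hu, Finsupp.filter_apply_neg (fun q : ℕ+ => n < (q : ℕ)) _
            (not_lt.2 hqn), sub_zero]
          exact hcoord q hqn
      _ = ((v - u).support.card : ℝ) * (η' / (n + 1)) := by simp
      _ ≤ n * (η' / (n + 1)) := by
          have h1 : (v - u).support.card ≤ n := by
            refine (card_le_card hsub).trans ?_
            exact card_image_le.trans (by simp)
          gcongr
  have huy : ‖toSpace m k u - y‖ ≤ η' := by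
    calc ‖toSpace m k u - y‖ = ‖(toSpace m k v - y) - toSpace m k (v - u)‖ := by
          congr 1; rw [map_sub]; abel
      _ ≤ ‖toSpace m k v - y‖ + ‖toSpace m k (v - u)‖ := norm_sub_le _ _
      _ ≤ η' / (n + 1) + n * (η' / (n + 1)) := by
          rw [norm_toSpace]; exact add_le_add hv.le hvu
      _ = η' := by field_simp; ring
  have hunorm : 1 / 2 ≤ mixedNorm m k u := by
    have h1 : ‖y‖ ≤ ‖toSpace m k u‖ + ‖toSpace m k u - y‖ := by
      rw [norm_sub_rev]
      calc ‖y‖ = ‖toSpace m k u + (y - toSpace m k u)‖ := by congr 1; abel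
        _ ≤ _ := norm_add_le _ _
    rw [hy1, norm_toSpace] at h1
    have := min_le_right (η / 2) (1 / 2)
    linarith
  have hpos : 0 < mixedNorm m k u := by linarith
  refine ⟨(mixedNorm m k u)⁻¹ • u, mixedNorm_normalize hpos, fun q hq => ?_,
    (mixedNorm m k u)⁻¹ • y, Y.smul_mem _ hyY, ?_⟩
  · have := Finsupp.support_smul hq
    simp only [hu, Finsupp.support_filter, mem_filter] at this
    exact this.2
  · rw [map_smul, ← smul_sub, norm_smul, norm_inv, Real.norm_of_nonneg hpos.le]
    have h2 : (mixedNorm m k u)⁻¹ ≤ 2 := by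
      rw [inv_le_comm₀ hpos (by norm_num)]; linarith
    calc (mixedNorm m k u)⁻¹ * ‖toSpace m k u - y‖ ≤ 2 * η' := by gcongr
      _ ≤ η := by have := min_le_left (η / 2) (1 / 2); linarith

/-- Every infinite-dimensional subspace is approximated by a block subspace. -/
theorem exists_block_subspace (G : GrowthData m k) {Y : Submodule ℝ (SpaceXM1u m k)}
    (hY : ¬FiniteDimensional ℝ Y) {η : ℝ} (hη : 0 < η) :
    ∃ U : Submodule ℝ (ℕ+ →₀ ℝ), TailNontrivial U ∧
      ∀ u ∈ U, ∃ y ∈ Y, ‖toSpace m k u - y‖ ≤ η * mixedNorm m k u := by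
  classical
  obtain ⟨P, uy, -, hst⟩ := exists_chain (I := fun _ : ℕ => True) (s₀ := 0)
    (R := fun L L' (uy : (ℕ+ →₀ ℝ) × SpaceXM1u m k) => L < L' ∧ mixedNorm m k uy.1 = 1 ∧
      (∀ q ∈ uy.1.support, L < (q : ℕ) ∧ (q : ℕ) ≤ L') ∧ uy.2 ∈ Y ∧
      ‖toSpace m k uy.1 - uy.2‖ ≤ η / 2 / 2 ^ L) trivial
    (fun L _ => by
      obtain ⟨u, hu1, huL, y, hyY, hy⟩ := exists_approximate_block hY L
        (η := η / 2 / 2 ^ L) (by positivity)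
      exact ⟨max (L + 1) (u.support.sup fun q => (q : ℕ)), (u, y), trivial, by omega, hu1,
        fun q hq => ⟨huL q hq, le_trans (le_sup (f := fun p : ℕ+ => (p : ℕ)) hq)
          (le_max_right _ _)⟩, hyY, hy⟩)
  replace hst := fun i => (hst i).2
  have hP : StrictMono P := strictMono_nat_of_lt_succ fun i => (hst i).1
  have hI : ∀ l, ∀ q ∈ (uy l).1.support, P l < (q : ℕ) ∧ (q : ℕ) ≤ P (l + 1) :=
    fun l => (hst l).2.2.1
  refine ⟨LinearMap.range (Finsupp.linearCombination ℝ fun l => (uy l).1), fun n => ?_, ?_⟩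
  · refine ⟨(uy n).1, ⟨Finsupp.single n 1, by simp⟩, fun h => ?_, fun q hq => ?_⟩
    · have h1 := (hst n).2.1
      rw [h] at h1
      have h2 := mixedNorm_smul (m := m) (k := k) 0 0
      rw [zero_smul, abs_zero, zero_mul] at h2
      linarith
    · exact (hP.le_apply (x := n)).trans_lt (hI n q hq).1
  · rintro _ ⟨c, rfl⟩
    set x := Finsupp.linearCombination ℝ (fun l => (uy l).1) c with hx
    -- Restriction to the `l`-th interval has norm at most `1` and isolates `c l` times a normalized
    -- block, so the errors sum to a geometric series bounded by `η` times the norm.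
    have hcl : ∀ l, |c l| ≤ mixedNorm m k x := by
      intro l
      let q : ℕ+ → Prop := fun a => P l < (a : ℕ) ∧ (a : ℕ) ≤ P (l + 1)
      have hfl : x.filter q = c l • (uy l).1 := by
        have hmap : x.filter q = ∑ i ∈ c.support, c i • ((uy i).1.filter q) := by
          rw [hx, Finsupp.linearCombination_apply, Finsupp.sum]
          ext a
          by_cases h : q a <;> simp [h]
        rw [hmap, Finset.sum_eq_single l]
        · congr 1
          rw [Finsupp.filter_eq_self_iff]
          exact fun a ha => hI l a (Finsupp.mem_support_iff.2 ha)
        · intro i _ hi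
          have : (uy i).1.filter q = 0 := by
            rw [Finsupp.filter_eq_zero_iff]
            intro a ha
            by_contra h
            exact hi (eq_of_mem_intervals hP (hI i a (Finsupp.mem_support_iff.2 h)) ha)
          rw [this, smul_zero]
        · intro h
          rw [Finsupp.notMem_support_iff.1 h, zero_smul]
      have h1 := mixedNorm_filter_le G x q
      rwa [hfl, mixedNorm_smul, (hst l).2.1, mul_one] at h1
    refine ⟨∑ l ∈ c.support, c l • (uy l).2, Y.sum_mem fun l _ => Y.smul_mem _ (hst l).2.2.2.1, ?_⟩
    have hdiff : toSpace m k x - ∑ l ∈ c.support, c l • (uy l).2 =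
        ∑ l ∈ c.support, c l • (toSpace m k (uy l).1 - (uy l).2) := by
      rw [hx, Finsupp.linearCombination_apply, Finsupp.sum, map_sum]
      simp only [map_smul, smul_sub, sum_sub_distrib]
    rw [hdiff]
    calc ‖∑ l ∈ c.support, c l • (toSpace m k (uy l).1 - (uy l).2)‖
        ≤ ∑ l ∈ c.support, mixedNorm m k x * (η / 2 / 2 ^ l) := by
          refine norm_sum_le_of_le _ fun l _ => ?_
          rw [norm_smul]
          refine mul_le_mul (hcl l) ((hst l).2.2.2.2.trans ?_) (norm_nonneg _) (mixedNorm_nonneg _)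
          have h1 : (2 : ℝ) ^ l ≤ 2 ^ P l := pow_le_pow_right₀ (by norm_num) hP.le_apply
          gcongr
      _ = mixedNorm m k x * ∑ l ∈ c.support, η / 2 / 2 ^ l := by rw [mul_sum]
      _ ≤ mixedNorm m k x * η := by
          refine mul_le_mul_of_nonneg_left ?_ (mixedNorm_nonneg _)
          exact ((summable_geometric_two' η).sum_le_tsum _ fun l _ => by positivity).trans_eq
            (tsum_geometric_two' η)
      _ = η * mixedNorm m k x := mul_comm _ _

/-! ### Flat and peak vectors in arbitrary subspaces -/

theorem weightSeminorm_le_add_norm_sub (s : ℕ) (x y : SpaceXM1u m k) :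
    weightSeminorm m k s x ≤ weightSeminorm m k s y + ‖x - y‖ := by
  calc weightSeminorm m k s x = weightSeminorm m k s (y + (x - y)) := by congr 1; abel
    _ ≤ weightSeminorm m k s y + weightSeminorm m k s (x - y) := map_add_le_add _ _ _
    _ ≤ _ := by gcongr; exact weightSeminorm_le_norm s _

/-- Every infinite-dimensional subspace contains a vector of norm at least `1 / 2` that is small
for the seminorm of weight `1 / m s`. -/
theorem exists_flat_mem (G : GrowthData m k) {Y : Submodule ℝ (SpaceXM1u m k)}
    (hY : ¬FiniteDimensional ℝ Y) {s : ℕ} (hs : 2 ≤ s) :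
    ∃ y ∈ Y, 1 / 2 ≤ ‖y‖ ∧ weightSeminorm m k s y ≤ 7 / (m s : ℝ) := by
  have hm : (5 : ℝ) ≤ m s := by exact_mod_cast G.five_le s hs
  have hm0 : (0 : ℝ) < m s := by linarith
  obtain ⟨U, hU, hUY⟩ := exists_block_subspace G hY (η := 1 / (m s : ℝ)) (by positivity)
  obtain ⟨v, hvU, hv1, hv⟩ := G.exists_flat_vector hU hs
  obtain ⟨y, hyY, hy⟩ := hUY v hvU
  rw [hv1, mul_one] at hy
  refine ⟨y, hyY, ?_, ?_⟩
  · have h1 : ‖toSpace m k v‖ ≤ ‖y‖ + ‖toSpace m k v - y‖ := by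
      calc ‖toSpace m k v‖ = ‖y + (toSpace m k v - y)‖ := by congr 1; abel
        _ ≤ _ := norm_add_le _ _
    rw [norm_toSpace, hv1] at h1
    have h2 : 1 / (m s : ℝ) ≤ 1 / 5 := one_div_le_one_div_of_le (by norm_num) hm
    linarith
  · have h1 := weightSeminorm_le_add_norm_sub s y (toSpace m k v)
    rw [norm_sub_rev] at h1
    have h2 : weightSeminorm m k s (toSpace m k v) ≤ 6 / (m s : ℝ) := by
      refine weightSeminorm_le (by positivity) fun f hf => ?_
      rw [evalSpace_toSpace hf.1, abs_le']
      refine ⟨hv f hf, ?_⟩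
      -- The flat vector is controlled from above only; symmetry of the set of functionals gives the
      -- absolute value.
      have hneg : -f ∈ weightSet m k s := by
        obtain ⟨hfK, A, hA, d, g, hg, hlt, hmin, rfl⟩ := hf
        refine ⟨neg_mem_normingSet hfK, A, hA, d, fun i => -g i,
          fun i => neg_mem_normingSet (hg i), ?_, ?_, ?_⟩
        · simpa only [Finsupp.support_neg] using hlt
        · intro i
          simpa only [minSupp, Finsupp.support_neg] using hmin i
        · rw [sum_neg_distrib, smul_neg]
      rw [← pairing_neg_right]
      exact hv _ hneg
    calc weightSeminorm m k s y ≤ 6 / (m s : ℝ) + 1 / (m s : ℝ) := by linarith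
      _ = 7 / (m s : ℝ) := by ring

/-- Every infinite-dimensional subspace contains a vector of small norm that is large for the
seminorm of weight `1 / m s`. -/
theorem exists_peak_mem (G : GrowthData m k) (t : ℕ) :
    ∃ s, 2 ≤ s ∧ ∀ Y : Submodule ℝ (SpaceXM1u m k), ¬FiniteDimensional ℝ Y →
      ∃ y ∈ Y, ‖y‖ ≤ 2 * (9 / 10) ^ t ∧ 1 / (4 * (m s : ℝ)) ≤ weightSeminorm m k s y := by
  obtain ⟨s, hs, h⟩ := G.exists_peak_vector t
  refine ⟨s, hs, fun Y hY => ?_⟩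
  have hm : (5 : ℝ) ≤ m s := by exact_mod_cast G.five_le s hs
  have hm0 : (0 : ℝ) < m s := by linarith
  -- The error is half of the peak value `1 / (2 * m s)` and, being proportional to the norm of `w`,
  -- at most doubles the bound `(9/10) ^ t`.
  obtain ⟨U, hU, hUY⟩ := exists_block_subspace G hY (η := 1 / (4 * (m s : ℝ))) (by positivity)
  obtain ⟨w, hwU, hw, f, hf, hfw⟩ := h U hU
  obtain ⟨y, hyY, hy⟩ := hUY w hwU
  have hη1 : 1 / (4 * (m s : ℝ)) ≤ 1 := by rw [div_le_one (by positivity)]; linarith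
  have hw0 := mixedNorm_nonneg (m := m) (k := k) w
  have hw1 : mixedNorm m k w ≤ 1 := hw.trans (pow_le_one₀ (by norm_num) (by norm_num))
  refine ⟨y, hyY, ?_, ?_⟩
  · have h1 : ‖y‖ ≤ ‖toSpace m k w‖ + ‖toSpace m k w - y‖ := by
      rw [norm_sub_rev]
      calc ‖y‖ = ‖toSpace m k w + (y - toSpace m k w)‖ := by congr 1; abel
        _ ≤ _ := norm_add_le _ _
    rw [norm_toSpace] at h1
    nlinarith
  · have h1 := weightSeminorm_le_add_norm_sub s (toSpace m k w) y
    have h2 := (le_abs_self _).trans (le_weightSeminorm hf (toSpace m k w))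
    rw [evalSpace_toSpace hf.1] at h2
    have h3 : 1 / (4 * (m s : ℝ)) * mixedNorm m k w ≤ 1 / (4 * (m s : ℝ)) :=
      mul_le_of_le_one_right (by positivity) hw1
    have h4 : 1 / (2 * (m s : ℝ)) = 1 / (4 * (m s : ℝ)) + 1 / (4 * (m s : ℝ)) := by
      field_simp; norm_num
    linarith

theorem isArbitrarilyDistortable_of_growthData (G : GrowthData m k) :
    IsArbitrarilyDistortable (SpaceXM1u m k) := by
  intro lam hlam
  -- The normalized peak has value at least `1 / (8 * m s * (9/10) ^ t)` and the normalized flat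
  -- vector at most `14 / m s`; `8 * 14 = 112`.
  obtain ⟨t, ht⟩ := exists_pow_lt_of_lt_one (show (0 : ℝ) < 1 / (112 * lam) by positivity)
    (show (9 / 10 : ℝ) < 1 by norm_num)
  obtain ⟨s, hs, hpeak⟩ := exists_peak_mem G t
  have hm : (5 : ℝ) ≤ m s := by exact_mod_cast G.five_le s hs
  have hm0 : (0 : ℝ) < m s := by linarith
  refine ⟨weightSeminorm m k s, ⟨1 / (m s : ℝ), 1, by positivity, one_pos, fun x =>
    ⟨norm_le_weightSeminorm G hs x, by rw [one_mul]; exact weightSeminorm_le_norm s x⟩⟩,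
    fun Y hY => ?_⟩
  obtain ⟨y, hyY, hy, hyN⟩ := hpeak Y hY
  obtain ⟨z, hzY, hz, hzN⟩ := exists_flat_mem G hY hs
  have hy0 : 0 < ‖y‖ := by
    have h1 : (0 : ℝ) < 1 / (4 * (m s : ℝ)) := by positivity
    exact (h1.trans_le hyN).trans_le (weightSeminorm_le_norm s y)
  have hz0 : 0 < ‖z‖ := by linarith
  have hNz0 : 0 < weightSeminorm m k s z :=
    lt_of_lt_of_le (by positivity) (norm_le_weightSeminorm G hs z)
  -- Needed because `sSup` of an unbounded set of reals is `0`; equivalence of the norms bounds all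
  -- ratios by `m s`.
  have hbdd : BddAbove {r : ℝ | ∃ y ∈ Y, ∃ z ∈ Y, ‖y‖ = 1 ∧ ‖z‖ = 1 ∧
      r = weightSeminorm m k s y / weightSeminorm m k s z} := by
    refine ⟨m s, ?_⟩
    rintro r ⟨a, -, b, -, ha, hb, rfl⟩
    have h1 := weightSeminorm_le_norm s a
    have h2 := norm_le_weightSeminorm G hs b
    rw [ha] at h1
    rw [hb, mul_one, div_le_iff₀ hm0] at h2
    have h3 : 0 < weightSeminorm m k s b := by
      by_contra h
      nlinarith
    rw [div_le_iff₀ h3]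
    linarith
  refine le_trans ?_ (le_csSup hbdd ⟨‖y‖⁻¹ • y, Y.smul_mem _ hyY, ‖z‖⁻¹ • z, Y.smul_mem _ hzY,
    ?_, ?_, rfl⟩)
  · rw [map_smul_eq_mul, map_smul_eq_mul, norm_inv, norm_inv, norm_norm, norm_norm,
      le_div_iff₀ (by positivity)]
    have hzb : ‖z‖⁻¹ * weightSeminorm m k s z ≤ 2 * (7 / (m s : ℝ)) := by
      have h2 : ‖z‖⁻¹ ≤ 2 := by rw [inv_le_comm₀ hz0 (by norm_num)]; linarith
      exact mul_le_mul h2 hzN hNz0.le (by norm_num)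
    have hyb : 14 * lam / (m s : ℝ) ≤ ‖y‖⁻¹ * weightSeminorm m k s y := by
      rw [inv_mul_eq_div, le_div_iff₀ hy0]
      refine le_trans ?_ hyN
      rw [lt_div_iff₀ (by positivity)] at ht
      calc 14 * lam / (m s : ℝ) * ‖y‖ ≤ 14 * lam / (m s : ℝ) * (2 * (9 / 10) ^ t) := by gcongr
        _ = ((9 / 10) ^ t * (112 * lam)) * (1 / (4 * (m s : ℝ))) := by field_simp; norm_num
        _ ≤ 1 * (1 / (4 * (m s : ℝ))) := by gcongr
        _ = _ := one_mul _
    calc lam * (‖z‖⁻¹ * weightSeminorm m k s z) ≤ lam * (2 * (7 / (m s : ℝ))) := by gcongr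
      _ = 14 * lam / (m s : ℝ) := by ring
      _ ≤ _ := hyb
  · rw [norm_smul, norm_inv, norm_norm, inv_mul_cancel₀ hy0.ne']
  · rw [norm_smul, norm_inv, norm_norm, inv_mul_cancel₀ hz0.ne']

end Space

theorem theorem2p18 (m t k : ℕ → ℕ)
    (hm1 : m 1 = 2)
    (hm : ∀ j, 2 ≤ j → m (j - 1) ^ m (j - 1) < m j)
    (ht : ∀ n, 2 ≤ n → m n ^ 2 ≤ 2 ^ t n)
    (hk1 : k 1 = 1)
    (hk : ∀ n, 2 ≤ n → k n = t n * (k (n - 1) + 1) + 1) :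
    IsArbitrarilyDistortable (SpaceXM1u m k) :=
  isArbitrarilyDistortable_of_growthData (growthData_of_recursion hm1 hm ht hk1 hk)
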